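/- **Setting.** Let $p\in\mathbb Z$, $q\in\mathbb N\setminus\{0\}$, $d\in q\mathbb N\setminus\{0\}$, and let $\|\cdot\|$ be any norm on $\mathbb R^2$. For $\theta\in\mathbb R$ let $\mathsf c_\theta(a,b)=\exp\big(i\pi\theta(b_1a_2-a_1b_2)\big)$ for $a,b\in\mathbb Z^2$, and let $\mathcal A_\theta=C^*(\mathbb Z^2,\mathsf c_\theta)$ be the quantum torus, i.e. the completion of the twisted convolution algebra $\ell^1(\mathbb Z^2)$ for the norm $\|f\|_{\mathcal A_\theta}=\sup_U\big\|\sum_{a}f(a)U^a\big\|$, the supremum being over all families $(U^a)_{a\in\mathbb Z^2}$ of unitaries on a Hilbert space with $U^aU^b=\mathsf c_\theta(a,b)U^{a+b}$. For $\theta\neq p/q$ put $\eth=\theta-p/q$, and let $\mathcal S(\mathbb C^d)$ be the space of Schwartz functions $\mathbb R\to\mathbb C^d$. For $\xi\in\mathcal S(\mathbb C^d)$ and $x,y\in\mathbb R$ let $$\sigma_{\eth,d}^{x,y}\xi(s)=\exp\big(2i\pi(\tfrac{\eth xy}{2}+sx)\big)\,\xi(s+\eth y)\qquad(s\in\mathbb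 R).$$ With $(e_j)_{j\in\mathbb Z/d}$ the canonical basis of $\mathbb C^d$, let $u,v$ be the unitaries $ue_j=e_{j+1\bmod d}$ and $ve_j=\exp(2i\pi pj/q)e_j$, and for $(n,m)\in\mathbb Z^2$ let $$\varpi^{n,m}\xi=\exp\big(\tfrac{i\pi pnm}{q}\big)\,u^nv^m\,\sigma_{\eth,d}^{n,m}\xi ,$$ a projective unitary representation of $\mathbb Z^2$ for $\mathsf c_\theta$. For $\xi,\omega\in\mathcal S(\mathbb C^d)$ put $\langle\xi,\omega\rangle_\theta(n,m)=\langle\varpi^{n,m}\xi,\omega\rangle_{L^2(\mathbb R,\mathbb C^d)}$ and $\|\xi\|_{\theta}=\|\langle\xi,\xi\rangle_\theta\|_{\mathcal A_\theta}^{1/2}$; the Heisenberg module $\mathscr H_\theta^{p,q,d}$ is the completion of $\mathcal S(\mathbb C^d)$ for $\|\cdot\|_\theta$. The D-norm is $$\mathsf D_\theta^{p,q,d}(\xi)=\sup\Big\{\|\xi\|_{\theta},\ \frac{\|\sigma_{\eth,d}^{x,y}\xi-\xi\|_{\theta}}{2\pi|\eth|\,\|(x,y)\|}:(x,y)\in\mathbb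 R^2\setminus\{0\}\Big\}\in[0,\infty].$$ **Theorem.** Let $\xi\in\mathcal S(\mathbb C^d)$ and let $\rho:\mathbb R\setminus\{p/q\}\to\mathbb R\setminus\{0\}$ be continuous. For $\theta\neq p/q$ let $\xi_{\rho(\theta)}(t)=\xi(\rho(\theta)t)$. Then for every $\theta\ne p/q$ the functions $\langle\eta,\omega\rangle_\theta$ ($\eta,\omega\in\mathcal S(\mathbb C^d)$) belong to $\ell^1(\mathbb Z^2)$ and $\mathsf D_\theta^{p,q,d}(\xi_{\rho(\theta)})<\infty$, and the function $$\theta\longmapsto\mathsf D_\theta^{p,q,d}\big(\xi_{\rho(\theta)}\big)$$ is continuous on $\mathbb R\setminus\{p/q\}$. -/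

import Mathlib

open scoped SchwartzMap ENNReal

namespace Heisenberg

noncomputable section

/-! ### Quantum tori -/

/-- The 2-cocycle `((x₁, y₁), (x₂, y₂)) ↦ exp (i π θ (x₂ y₁ - x₁ y₂))` of `ℝ²`,
restricted to `ℤ²`. -/
def cocycle (θ : ℝ) (a b : ℤ × ℤ) : ℂ :=
  Complex.exp (Complex.I * Real.pi * θ * ((b.1 : ℂ) * a.2 - (a.1 : ℂ) * b.2))

/-- `U` is a projective unitary representation of `ℤ²` on the Hilbert space `H` for the
2-cocycle `cocycle θ`. -/
def IsProjRep (θ : ℝ) {H : Type} [NormedAddCommGroup H] [InnerProductSpace ℂ H]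
    [CompleteSpace H] (U : ℤ × ℤ → H →L[ℂ] H) : Prop :=
  (∀ a, U a ∈ unitary (H →L[ℂ] H)) ∧ ∀ a b, U a * U b = cocycle θ a b • U (a + b)

/-- The norm, in the quantum torus `C*(ℤ², cocycle θ)`, of an element `f` of the dense subalgebra
`ℓ¹(ℤ²)`: the largest C*-norm of the twisted convolution algebra, that is, the supremum of
the operator norms of `∑ f(a) U(a)` over all projective unitary representations `U` for
`cocycle θ`. (It is meant for absolutely summable `f` only.) -/
def torusNorm (θ : ℝ) (f : ℤ × ℤ → ℂ) : ℝ≥0∞ :=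
  ⨆ (H : Type) (_ : NormedAddCommGroup H) (_ : InnerProductSpace ℂ H) (_ : CompleteSpace H)
    (U : ℤ × ℤ → H →L[ℂ] H) (_ : IsProjRep θ U), ‖∑' a, f a • U a‖ₑ

/-! ### The Schrödinger representation on Schwartz functions -/

/-- `ℂ^d` with its usual Hermitian norm. The canonical basis is indexed by `0, …, d - 1`, i.e. by
the residues modulo `d`. -/
abbrev Cd (d : ℕ) : Type := EuclideanSpace ℂ (Fin d)

/-- The character `s ↦ exp (2 i π s x)` of `ℝ`. -/
def character (x s : ℝ) : ℂ := Complex.exp (2 * Complex.I * Real.pi * (s * x))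

theorem character_hasTemperateGrowth (x : ℝ) : (character x).HasTemperateGrowth := by
  have h : character x =
      fun s : ℝ => (fun z : ℂ => Complex.exp (2 * Complex.I * Real.pi * x * z)) (s : ℂ) := by
    funext s
    simp only [character]
    congr 1
    ring
  have hd : ∀ n : ℕ, iteratedDeriv n (character x) =
      fun s => (2 * Complex.I * Real.pi * x) ^ n * character x s := by
    intro n
    induction n with
    | zero => simp
    | succ n ih =>
      rw [iteratedDeriv_succ, ih]
      funext s
      have h1 : HasDerivAt (character x) (character x s * (2 * Complex.I * Real.pi * x)) s := by
        rw [h]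
        have h2 : HasDerivAt (fun z : ℂ => Complex.exp (2 * Complex.I * Real.pi * x * z))
            (Complex.exp (2 * Complex.I * Real.pi * x * (s : ℂ))
              * (2 * Complex.I * Real.pi * x)) (s : ℂ) := by
          simpa using ((hasDerivAt_id (s : ℂ)).const_mul (2 * Complex.I * Real.pi * x)).cexp
        exact h2.comp_ofReal
      rw [(h1.const_mul _).deriv]
      ring
  refine ⟨?_, fun n => ⟨0, ‖(2 * Complex.I * Real.pi * x : ℂ)‖ ^ n, fun s => ?_⟩⟩
  · rw [h]
    have h3 : ContDiff ℝ (⊤ : ℕ∞) (fun s : ℝ => (s : ℂ)) := Complex.ofRealCLM.contDiff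
    exact (contDiff_const.mul h3).cexp
  · rw [norm_iteratedFDeriv_eq_norm_iteratedDeriv, hd]
    have : ‖character x s‖ = 1 := by
      have := Complex.norm_exp_ofReal_mul_I (2 * Real.pi * (s * x))
      rw [← this, character]
      congr 2
      push_cast
      ring
    simp [this]

/-- The representation of the Heisenberg group on Schwartz functions:
`(heisRep ð x y u ξ)(s) = exp (2 i π (ð u + s x)) ξ(s + ð y)`. -/
def heisRep {d : ℕ} (ð x y u : ℝ) (ξ : 𝓢(ℝ, Cd d)) : 𝓢(ℝ, Cd d) :=
  Complex.exp (2 * Complex.I * Real.pi * (ð * u)) •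
    SchwartzMap.smulLeftCLM (Cd d) (character x) (SchwartzMap.compSubConstCLM ℂ (-(ð * y)) ξ)

theorem heisRep_apply {d : ℕ} (ð x y u : ℝ) (ξ : 𝓢(ℝ, Cd d)) (s : ℝ) :
    heisRep ð x y u ξ s =
      Complex.exp (2 * Complex.I * Real.pi * (ð * u + s * x)) • ξ (s + ð * y) := by
  rw [heisRep, smul_apply,
    SchwartzMap.smulLeftCLM_apply_apply (character_hasTemperateGrowth x),
    SchwartzMap.compSubConstCLM_apply, sub_neg_eq_add, smul_smul, character, ← Complex.exp_add,
    mul_add]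

/-- The Schrödinger representation `σ_{ð,d}^{x,y}` of `ℝ²` for the Planck constant `ð`. -/
def schrodinger {d : ℕ} (ð x y : ℝ) (ξ : 𝓢(ℝ, Cd d)) : 𝓢(ℝ, Cd d) :=
  heisRep ð x y (x * y / 2) ξ

/-! ### Heisenberg modules -/

/-- The cyclic shift `e_j ↦ e_{(j+1) mod d}` of `ℂ^d`. -/
def shift (d : ℕ) : Cd d ≃ₗᵢ[ℂ] Cd d :=
  LinearIsometryEquiv.piLpCongrLeft 2 ℂ ℂ (finRotate d)

/-- Multiplication by `exp (2 i π r)` on `ℂ`. -/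
def phase (r : ℝ) : ℂ ≃ₗᵢ[ℂ] ℂ where
  toLinearEquiv := LinearEquiv.smulOfNeZero ℂ ℂ
    (Complex.exp (((2 * Real.pi * r : ℝ) : ℂ) * Complex.I)) (Complex.exp_ne_zero _)
  norm_map' z := by
    change ‖Complex.exp _ * z‖ = ‖z‖
    rw [norm_mul, Complex.norm_exp_ofReal_mul_I, one_mul]

/-- The diagonal unitary `e_j ↦ exp (2 i π p j / q) e_j` of `ℂ^d`. -/
def clock (p : ℤ) (q d : ℕ) : Cd d ≃ₗᵢ[ℂ] Cd d :=
  LinearIsometryEquiv.piLpCongrRight 2 fun j : Fin d => phase ((p : ℝ) * (j : ℕ) / q)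

/-- The projective unitary representation `ϖ` of `ℤ²` attached to `p`, `q`, `d` and `θ`:
`ϖ^{n,m} ξ = exp (i π p n m / q) u^n v^m σ_{ð,d}^{n,m} ξ` with `ð = θ - p / q`, where `u` is
the cyclic shift and `v` the diagonal unitary. -/
def latticeRep (p : ℤ) (q d : ℕ) (θ : ℝ) (a : ℤ × ℤ) (ξ : 𝓢(ℝ, Cd d)) : 𝓢(ℝ, Cd d) :=
  Complex.exp (Complex.I * Real.pi * p * a.1 * a.2 / q) •
    SchwartzMap.postcompCLM
      ((shift d ^ a.1 * clock p q d ^ a.2 : Cd d ≃ₗᵢ[ℂ] Cd d) : Cd d →L[ℂ] Cd d)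
      (schrodinger (θ - p / q) a.1 a.2 ξ)

/-- The `C*(ℤ², cocycle θ)`-valued inner product of the Heisenberg module: the function
`(n, m) ↦ ⟨ϖ^{n,m} ξ, ω⟩` on `ℤ²`, where `⟨·, ·⟩` is the inner product of `L²(ℝ, ℂ^d)`, linear
in its first argument (Mathlib's `inner ℂ` is linear in the second one). -/
def moduleInner (p : ℤ) (q d : ℕ) (θ : ℝ) (ξ ω : 𝓢(ℝ, Cd d)) (a : ℤ × ℤ) : ℂ :=
  ∫ s : ℝ, inner ℂ (ω s) (latticeRep p q d θ a ξ s)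

/-- The norm of the Heisenberg module on its dense subspace of Schwartz functions: the square
root of the norm of `⟨ξ, ξ⟩` in the quantum torus. -/
def moduleNorm (p : ℤ) (q d : ℕ) (θ : ℝ) (ξ : 𝓢(ℝ, Cd d)) : ℝ≥0∞ :=
  torusNorm θ (moduleInner p q d θ ξ ξ) ^ (1 / 2 : ℝ)

/-- The D-norm of a Schwartz function, for a norm `N` on `ℝ²`:
the supremum of `‖ξ‖` and of all `‖σ^{x,y} ξ - ξ‖ / (2 π |ð| N(x, y))`, `(x, y) ≠ 0`. -/
def dNorm (N : Seminorm ℝ (ℝ × ℝ)) (p : ℤ) (q d : ℕ) (θ : ℝ) (ξ : 𝓢(ℝ, Cd d)) : ℝ≥0∞ :=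
  moduleNorm p q d θ ξ ⊔
    ⨆ (z : ℝ × ℝ) (_ : z ≠ 0),
      moduleNorm p q d θ (schrodinger (θ - p / q) z.1 z.2 ξ - ξ) /
        ENNReal.ofReal (2 * Real.pi * |θ - p / q| * N z)

/-- The rescaling `t ↦ ξ(r t)` of a Schwartz function, for `r ≠ 0`. -/
def rescale {d : ℕ} (r : {r : ℝ // r ≠ 0}) (ξ : 𝓢(ℝ, Cd d)) : 𝓢(ℝ, Cd d) :=
  SchwartzMap.compCLMOfContinuousLinearEquiv ℂ
    (ContinuousLinearEquiv.unitsEquivAut ℝ (Units.mk0 r.1 r.2)) ξ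

theorem rescale_apply {d : ℕ} (r : {r : ℝ // r ≠ 0}) (ξ : 𝓢(ℝ, Cd d)) (t : ℝ) :
    rescale r ξ t = ξ (r.1 * t) := by
  simp [rescale, mul_comm]

end

end Heisenberg

/-!
Write `ð = θ - p / q`, `σ` for the Schrödinger representation and `ϖ` for the projective
representation of `ℤ²` on Schwartz functions. The D-norm is a supremum over all `z ≠ 0` of
difference quotients of `σ`, and a supremum of continuous functions is only lower semicontinuous.
The point is that it is a maximum over a compact set of a jointly continuous function.

*The D-norm through derivatives.* Conjugation by `σ^z` multiplies `⟨ξ, ξ⟩` by a character of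
`ℤ²`, so `σ^z` is isometric for the module norm. Hence telescoping along the one-parameter group
`t ↦ σ^{tz}` gives `‖σ^z ξ - ξ‖ ≤ n ‖σ^{z/n} ξ - ξ‖`, and in the limit
`‖σ^z ξ - ξ‖ ≤ ‖∇_z ξ‖`, where `∇_z ξ (s) = 2 i π x s ξ(s) + ð y ξ'(s)` for `z = (x, y)`
(`moduleNormReal_schrodinger_sub_le`). As the difference quotients converge to the derivative,
the D-norm is the maximum of `‖ξ‖` and of `‖∇_z ξ‖ / (2 π |ð| N z)` for `z` on the unit sphere
(`dNorm_ne_top_and_toReal_eq`).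

*The module norm is subadditive.* This comes from the positivity of `⟨ξ, ξ⟩` in each
representation (`isPositive_tsum_moduleInner`): the function `a ↦ ⟨ϖ^a ξ, ξ⟩ ⟨U^{-a} h, h⟩` is of
positive type on the group `ℤ²`, and averaging over large squares shows that its sum is
nonnegative.

*Joint continuity.* The quantum tori form a continuous field. If `U` is a projective representation
for `θ`, its tensor product with the regular projective representation on `ℓ²(ℤ²)` for a small
parameter `δ` is one for `θ + δ`, and `b ↦ r ^ |b|` with `r` close to `1` is an almost invariant
vector of the second factor. This bounds the norm of `f` for `θ` by its norm for `θ + δ`, up to a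
small error, whence continuity in `θ` (`tendsto_torusNormReal`). On the other hand `⟨ξ, ξ⟩` depends
continuously on `θ` and `ξ` as an element of `ℓ¹(ℤ²)`, by dominated convergence: its value at
`(n, m)` is at most a constant times `(1 + n²)⁻¹ (1 + m²)⁻¹`, by the decay of `ξ` for `m` and by
integration by parts for `n` (`norm_moduleInner_le_latticeMajorant`). Together they make the module
norm continuous along families of Schwartz functions with a locally uniform decay
(`continuous_moduleNormReal`), in particular along the derivatives of the rescaled function.
-/

namespace Heisenberg

open Filter Topology MeasureTheory

/-! ### The cocycle -/

theorem cocycle_eq_exp (θ : ℝ) (a b : ℤ × ℤ) :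
    cocycle θ a b =
      Complex.exp (((Real.pi * θ * ((b.1 : ℝ) * a.2 - a.1 * b.2) : ℝ) : ℂ) * Complex.I) := by
  rw [cocycle]
  congr 1
  push_cast
  ring

theorem norm_cocycle (θ : ℝ) (a b : ℤ × ℤ) : ‖cocycle θ a b‖ = 1 := by
  rw [cocycle_eq_exp, Complex.norm_exp_ofReal_mul_I]

theorem cocycle_neg_right_self (θ : ℝ) (a : ℤ × ℤ) : cocycle θ a (-a) = 1 := by
  rw [cocycle, ← Complex.exp_zero]
  congr 1
  simp only [Prod.fst_neg, Prod.snd_neg]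
  push_cast
  ring

theorem cocycle_zero_left (θ : ℝ) (b : ℤ × ℤ) : cocycle θ 0 b = 1 := by
  simp [cocycle]

theorem cocycle_neg_neg (θ : ℝ) (a b : ℤ × ℤ) : cocycle θ (-a) (-b) = cocycle θ a b := by
  simp [cocycle]

theorem cocycle_parameter_add (θ δ : ℝ) (a b : ℤ × ℤ) :
    cocycle (θ + δ) a b = cocycle θ a b * cocycle δ a b := by
  rw [cocycle, cocycle, cocycle, ← Complex.exp_add]
  congr 1
  push_cast
  ring

theorem continuous_cocycle (a b : ℤ × ℤ) : Continuous fun θ => cocycle θ a b := by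
  unfold cocycle
  fun_prop

theorem cocycle_zero_parameter (a b : ℤ × ℤ) : cocycle 0 a b = 1 := by
  simp [cocycle]

/-! ### Projective representations -/

section ProjRep

variable {H : Type} [NormedAddCommGroup H] [InnerProductSpace ℂ H] [CompleteSpace H]
  {θ : ℝ} {U : ℤ × ℤ → H →L[ℂ] H}

theorem IsProjRep.norm_map (hU : IsProjRep θ U) (a : ℤ × ℤ) (h : H) : ‖U a h‖ = ‖h‖ :=
  (ContinuousLinearMap.norm_map_iff_adjoint_comp_self (U a)).2
    (Unitary.star_mul_self_of_mem (hU.1 a)) h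

theorem IsProjRep.norm_le_one (hU : IsProjRep θ U) (a : ℤ × ℤ) : ‖U a‖ ≤ 1 :=
  ContinuousLinearMap.opNorm_le_bound _ zero_le_one fun h => by rw [hU.norm_map, one_mul]

theorem IsProjRep.map_zero (hU : IsProjRep θ U) : U 0 = 1 := by
  have h := hU.2 0 0
  rw [cocycle_zero_left, one_smul, add_zero] at h
  calc U 0 = star (U 0) * U 0 * U 0 := by rw [Unitary.star_mul_self_of_mem (hU.1 0), one_mul]
    _ = 1 := by rw [mul_assoc, h, Unitary.star_mul_self_of_mem (hU.1 0)]

theorem IsProjRep.mul_neg (hU : IsProjRep θ U) (a : ℤ × ℤ) : U a * U (-a) = 1 := by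
  rw [hU.2, cocycle_neg_right_self, one_smul, add_neg_cancel, hU.map_zero]

theorem IsProjRep.adjoint_eq (hU : IsProjRep θ U) (a : ℤ × ℤ) : star (U a) = U (-a) := by
  calc star (U a) = star (U a) * (U a * U (-a)) := by rw [hU.mul_neg, mul_one]
    _ = U (-a) := by rw [← mul_assoc, Unitary.star_mul_self_of_mem (hU.1 a), one_mul]

/-- A family of isometries with the multiplication law of a projective representation consists of
unitaries, since each of them has a right inverse. -/
theorem isProjRep_of_isometry (hiso : ∀ a h, ‖U a h‖ = ‖h‖)
    (hzero : U 0 = 1) (hmul : ∀ a b, U a * U b = cocycle θ a b • U (a + b)) : IsProjRep θ U := by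
  refine ⟨fun a => ?_, hmul⟩
  have h1 : star (U a) * U a = 1 :=
    (ContinuousLinearMap.norm_map_iff_adjoint_comp_self (U a)).1 (hiso a)
  have h2 : U a * U (-a) = 1 := by
    rw [hmul, cocycle_neg_right_self, one_smul, add_neg_cancel, hzero]
  have h3 : star (U a) = U (-a) := by
    calc star (U a) = star (U a) * (U a * U (-a)) := by rw [h2, mul_one]
      _ = U (-a) := by rw [← mul_assoc, h1, one_mul]
  rw [Unitary.mem_iff]
  exact ⟨h1, by rw [h3, h2]⟩

theorem IsProjRep.comp_neg (hU : IsProjRep θ U) : IsProjRep θ fun a => U (-a) :=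
  ⟨fun a => hU.1 (-a), fun a b => by simp only [hU.2, cocycle_neg_neg, neg_add]⟩

/-- The dual action: multiplying a projective representation by a character of `ℤ²` gives a
projective representation for the same cocycle. -/
theorem IsProjRep.smul_character (hU : IsProjRep θ U) {χ : ℤ × ℤ → ℂ} (h1 : ∀ a, ‖χ a‖ = 1)
    (hχ : ∀ a b, χ (a + b) = χ a * χ b) : IsProjRep θ fun a => χ a • U a := by
  refine isProjRep_of_isometry (fun a h => ?_) ?_ fun a b => ?_
  · rw [smul_apply, norm_smul, h1, one_mul, hU.norm_map]
  · have h0 : χ 0 = 1 := by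
      have h := hχ 0 0
      rw [add_zero] at h
      have hne : χ 0 ≠ 0 := norm_ne_zero_iff.1 (by rw [h1]; exact one_ne_zero)
      exact (mul_right_cancel₀ hne (by rw [one_mul, ← h]))
    rw [h0, hU.map_zero, one_smul]
  · rw [smul_mul_smul_comm, hU.2, hχ, smul_smul, smul_smul, mul_comm]

theorem IsProjRep.summable_smul (hU : IsProjRep θ U) {f : ℤ × ℤ → ℂ}
    (hf : Summable fun a => ‖f a‖) : Summable fun a => f a • U a :=
  Summable.of_norm_bounded hf fun a => by
    rw [norm_smul]
    exact mul_le_of_le_one_right (norm_nonneg _) (hU.norm_le_one a)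

theorem IsProjRep.norm_tsum_smul_le (hU : IsProjRep θ U) {f : ℤ × ℤ → ℂ}
    (hf : Summable fun a => ‖f a‖) : ‖∑' a, f a • U a‖ ≤ ∑' a, ‖f a‖ :=
  tsum_of_norm_bounded hf.hasSum fun a => by
    rw [norm_smul]
    exact mul_le_of_le_one_right (norm_nonneg _) (hU.norm_le_one a)

end ProjRep

/-! ### The norm of the quantum torus -/

/-- The real-valued version of `torusNorm`, meaningful for absolutely summable functions. -/
noncomputable def torusNormReal (θ : ℝ) (f : ℤ × ℤ → ℂ) : ℝ := (torusNorm θ f).toReal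

theorem torusNormReal_nonneg (θ : ℝ) (f : ℤ × ℤ → ℂ) : 0 ≤ torusNormReal θ f :=
  ENNReal.toReal_nonneg

theorem torusNorm_le {θ : ℝ} {f : ℤ × ℤ → ℂ} {C : ℝ}
    (h : ∀ (H : Type) [NormedAddCommGroup H] [InnerProductSpace ℂ H] [CompleteSpace H]
      (U : ℤ × ℤ → H →L[ℂ] H), IsProjRep θ U → ‖∑' a, f a • U a‖ ≤ C) :
    torusNorm θ f ≤ ENNReal.ofReal C := by
  refine iSup_le fun H => iSup_le fun _ => iSup_le fun _ => iSup_le fun _ => iSup_le fun U =>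
    iSup_le fun hU => ?_
  rw [← ofReal_norm]
  exact ENNReal.ofReal_le_ofReal (h H U hU)

theorem torusNormReal_le {θ : ℝ} {f : ℤ × ℤ → ℂ} {C : ℝ} (hC : 0 ≤ C)
    (h : ∀ (H : Type) [NormedAddCommGroup H] [InnerProductSpace ℂ H] [CompleteSpace H]
      (U : ℤ × ℤ → H →L[ℂ] H), IsProjRep θ U → ‖∑' a, f a • U a‖ ≤ C) :
    torusNormReal θ f ≤ C :=
  ENNReal.toReal_le_of_le_ofReal hC (torusNorm_le h)

theorem torusNorm_ne_top {θ : ℝ} {f : ℤ × ℤ → ℂ} (hf : Summable fun a => ‖f a‖) :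
    torusNorm θ f ≠ ⊤ :=
  ne_top_of_le_ne_top ENNReal.ofReal_ne_top
    (torusNorm_le fun _ _ _ _ _ hU => hU.norm_tsum_smul_le hf)

theorem IsProjRep.norm_le_torusNormReal {H : Type} [NormedAddCommGroup H] [InnerProductSpace ℂ H]
    [CompleteSpace H] {θ : ℝ} {U : ℤ × ℤ → H →L[ℂ] H} (hU : IsProjRep θ U) {f : ℤ × ℤ → ℂ}
    (hf : Summable fun a => ‖f a‖) : ‖∑' a, f a • U a‖ ≤ torusNormReal θ f := by
  rw [torusNormReal, ← ENNReal.ofReal_le_iff_le_toReal (torusNorm_ne_top hf), ofReal_norm,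
    torusNorm]
  exact le_iSup_of_le H <| le_iSup_of_le _ <| le_iSup_of_le _ <| le_iSup_of_le _ <|
    le_iSup_of_le U <| le_iSup_of_le hU le_rfl

theorem torusNormReal_le_add_tsum {θ : ℝ} {f g : ℤ × ℤ → ℂ} (hf : Summable fun a => ‖f a‖)
    (hg : Summable fun a => ‖g a‖) :
    torusNormReal θ f ≤ torusNormReal θ g + ∑' a, ‖f a - g a‖ := by
  have hfg : Summable fun a => ‖f a - g a‖ :=
    Summable.of_nonneg_of_le (fun _ => norm_nonneg _) (fun a => norm_sub_le _ _) (hf.add hg)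
  refine torusNormReal_le (add_nonneg (torusNormReal_nonneg _ _)
    (tsum_nonneg fun _ => norm_nonneg _)) fun H _ _ _ U hU => ?_
  have h : ∑' a, f a • U a = ∑' a, g a • U a + ∑' a, (f a - g a) • U a := by
    rw [← (hU.summable_smul hg).tsum_add (hU.summable_smul hfg)]
    simp [sub_smul]
  rw [h]
  exact (norm_add_le _ _).trans
    (add_le_add (hU.norm_le_torusNormReal hg) (hU.norm_tsum_smul_le hfg))

theorem torusNormReal_const_mul (θ : ℝ) {f : ℤ × ℤ → ℂ} (hf : Summable fun a => ‖f a‖) (c : ℂ) :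
    torusNormReal θ (fun a => c * f a) ≤ ‖c‖ * torusNormReal θ f := by
  refine torusNormReal_le (mul_nonneg (norm_nonneg _) (torusNormReal_nonneg _ _))
    fun H _ _ _ U hU => ?_
  have h : ∑' a, (c * f a) • U a = c • ∑' a, f a • U a := by
    rw [← (hU.summable_smul hf).tsum_const_smul]
    simp [smul_smul]
  rw [h, norm_smul]
  exact mul_le_mul_of_nonneg_left (hU.norm_le_torusNormReal hf) (norm_nonneg _)

/-- The dual action of a character of `ℤ²` does not increase the norm of the quantum torus. -/
theorem torusNormReal_character_mul_le (θ : ℝ) {f : ℤ × ℤ → ℂ} (hf : Summable fun a => ‖f a‖)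
    {χ : ℤ × ℤ → ℂ} (h1 : ∀ a, ‖χ a‖ = 1) (hχ : ∀ a b, χ (a + b) = χ a * χ b) :
    torusNormReal θ (fun a => χ a * f a) ≤ torusNormReal θ f := by
  refine torusNormReal_le (torusNormReal_nonneg _ _) fun H _ _ _ U hU => ?_
  have h := (hU.smul_character h1 hχ).norm_le_torusNormReal hf
  simpa only [smul_smul, mul_comm] using h

/-! ### Continuity of the norm in the parameter of the quantum torus -/

section TwistedTranslation

section

variable {H : Type} [NormedAddCommGroup H]

/-- The Hilbert space `ℓ²(ℤ², H) = ℓ²(ℤ²) ⊗ H`. -/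
abbrev LatticeL2 (H : Type) [NormedAddCommGroup H] : Type := lp (fun _ : ℤ × ℤ => H) 2

theorem summable_sq (Φ : LatticeL2 H) : Summable fun b => ‖Φ b‖ ^ 2 := by
  have h := (lp.memℓp Φ).summable (by norm_num)
  simpa using h

theorem norm_sq_eq_tsum (Φ : LatticeL2 H) : ‖Φ‖ ^ 2 = ∑' b, ‖Φ b‖ ^ 2 := by
  have h := lp.norm_rpow_eq_tsum (p := 2) (by norm_num) Φ
  simpa using h

theorem memℓp_two_of_summable {f : ℤ × ℤ → H} (h : Summable fun b => ‖f b‖ ^ 2) :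
    Memℓp f 2 :=
  memℓp_gen (by simpa using h)

end

variable {H : Type} [NormedAddCommGroup H] [InnerProductSpace ℂ H] [CompleteSpace H]

/-- The operator `Φ ↦ (b ↦ c(b) T Φ(b - a))` of `ℓ²(ℤ², H)`, where `T` is an isometry of `H` and
`c` takes values of modulus one. -/
noncomputable def twistedTranslation (T : H →L[ℂ] H) (hT : ∀ h, ‖T h‖ = ‖h‖) (c : ℤ × ℤ → ℂ)
    (hc : ∀ b, ‖c b‖ = 1) (a : ℤ × ℤ) : LatticeL2 H →ₗᵢ[ℂ] LatticeL2 H :=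
  have key : ∀ Φ : LatticeL2 H, ∀ b, ‖c b • T (Φ (b - a))‖ ^ 2 = ‖Φ (b - a)‖ ^ 2 := fun Φ b => by
    rw [norm_smul, hc, one_mul, hT]
  { toFun := fun Φ => ⟨fun b => c b • T (Φ (b - a)), memℓp_two_of_summable (by
      simp_rw [key]
      exact (Equiv.subRight a).summable_iff.2 (summable_sq Φ))⟩
    map_add' := fun Φ Ψ => by
      ext b
      simp only [lp.coeFn_add, Pi.add_apply, map_add, smul_add]
    map_smul' := fun z Φ => by
      ext b
      simp [smul_comm z]
    norm_map' := fun Φ => by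
      rw [← sq_eq_sq₀ (norm_nonneg _) (norm_nonneg _), norm_sq_eq_tsum, norm_sq_eq_tsum]
      change ∑' b, ‖c b • T (Φ (b - a))‖ ^ 2 = _
      simp_rw [key]
      exact (Equiv.subRight a).tsum_eq fun b => ‖Φ b‖ ^ 2 }

/-- The tensor product of a projective representation for the parameter `θ` with the regular one
for the parameter `δ`. -/
noncomputable def regularTensor {θ : ℝ} {U : ℤ × ℤ → H →L[ℂ] H} (hU : IsProjRep θ U) (δ : ℝ)
    (a : ℤ × ℤ) : LatticeL2 H →L[ℂ] LatticeL2 H :=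
  (twistedTranslation (U a) (hU.norm_map a) (cocycle δ a) (norm_cocycle δ a)
    a).toContinuousLinearMap

theorem regularTensor_apply {θ : ℝ} {U : ℤ × ℤ → H →L[ℂ] H} (hU : IsProjRep θ U) (δ : ℝ)
    (a : ℤ × ℤ) (Φ : LatticeL2 H) (b : ℤ × ℤ) :
    regularTensor hU δ a Φ b = cocycle δ a b • U a (Φ (b - a)) := rfl

theorem isProjRep_regularTensor {θ : ℝ} {U : ℤ × ℤ → H →L[ℂ] H} (hU : IsProjRep θ U) (δ : ℝ) :
    IsProjRep (θ + δ) (regularTensor hU δ) := by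
  refine isProjRep_of_isometry (fun a Φ => LinearIsometry.norm_map _ Φ) ?_ fun a a' => ?_
  · ext Φ b
    rw [regularTensor_apply, cocycle_zero_left, one_smul, sub_zero, hU.map_zero]
    rfl
  · ext Φ b
    change regularTensor hU δ a (regularTensor hU δ a' Φ) b =
      cocycle (θ + δ) a a' • (regularTensor hU δ (a + a') Φ b)
    have h1 : U a (U a' (Φ (b - a - a'))) = cocycle θ a a' • U (a + a') (Φ (b - (a + a'))) := by
      have h := congrArg (fun T : H →L[ℂ] H => T (Φ (b - (a + a')))) (hU.2 a a')
      rw [sub_sub]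
      exact h
    have h2 : cocycle δ a b * cocycle δ a' (b - a) = cocycle δ a a' * cocycle δ (a + a') b := by
      simp only [cocycle, ← Complex.exp_add]
      congr 1
      simp only [Prod.fst_sub, Prod.snd_sub, Prod.fst_add, Prod.snd_add]
      push_cast
      ring
    rw [regularTensor_apply, regularTensor_apply, regularTensor_apply, map_smul, h1, smul_smul,
      smul_smul, h2, smul_smul, cocycle_parameter_add]
    congr 1
    ring

end TwistedTranslation

/-- The `ℓ¹` length of an element of `ℤ²`. -/
def latticeLength (b : ℤ × ℤ) : ℕ := b.1.natAbs + b.2.natAbs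

theorem summable_pow_natAbs {r : ℝ} (h0 : 0 ≤ r) (h1 : r < 1) :
    Summable fun n : ℤ => r ^ n.natAbs :=
  Summable.of_nat_of_neg (by simpa using summable_geometric_of_lt_one h0 h1)
    (by simpa using summable_geometric_of_lt_one h0 h1)

theorem summable_pow_latticeLength {r : ℝ} (h0 : 0 ≤ r) (h1 : r < 1) :
    Summable fun b => r ^ latticeLength b := by
  simp only [latticeLength, pow_add]
  exact (summable_pow_natAbs h0 h1).mul_of_nonneg (summable_pow_natAbs h0 h1)
    (fun _ => pow_nonneg h0 _) fun _ => pow_nonneg h0 _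

theorem summable_sq_pow_latticeLength {r : ℝ} (h0 : 0 ≤ r) (h1 : r < 1) :
    Summable fun b => (r ^ latticeLength b) ^ 2 := by
  simp only [← pow_mul, mul_comm _ 2]
  simp only [pow_mul]
  exact summable_pow_latticeLength (sq_nonneg r) (pow_lt_one₀ h0 h1 two_ne_zero)

theorem tsum_sq_pow_latticeLength_pos {r : ℝ} (h0 : 0 < r) (h1 : r < 1) :
    0 < ∑' b, (r ^ latticeLength b) ^ 2 :=
  (summable_sq_pow_latticeLength h0.le h1).tsum_pos (fun _ => sq_nonneg _) 0 (by positivity)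

/-- The squared relative distance between the vector `b ↦ r ^ |b|` of `ℓ²(ℤ²)` and its image under
the regular projective representation for the parameter `δ`, at `a ∈ ℤ²`. -/
noncomputable def displacement (δ r : ℝ) (a : ℤ × ℤ) : ℝ :=
  (∑' b, ‖cocycle δ a b * ((r ^ latticeLength (b - a) : ℝ) : ℂ) -
    ((r ^ latticeLength b : ℝ) : ℂ)‖ ^ 2) / ∑' b, (r ^ latticeLength b) ^ 2

section

variable {r : ℝ}

theorem displacement_term_le (h0 : 0 ≤ r) (δ : ℝ) (a b : ℤ × ℤ) :
    ‖cocycle δ a b * ((r ^ latticeLength (b - a) : ℝ) : ℂ) - ((r ^ latticeLength b : ℝ) : ℂ)‖ ^ 2 ≤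
      2 * (r ^ latticeLength (b - a)) ^ 2 + 2 * (r ^ latticeLength b) ^ 2 := by
  have h := norm_sub_le (cocycle δ a b * ((r ^ latticeLength (b - a) : ℝ) : ℂ))
    ((r ^ latticeLength b : ℝ) : ℂ)
  rw [norm_mul, norm_cocycle, one_mul, Complex.norm_of_nonneg (pow_nonneg h0 _),
    Complex.norm_of_nonneg (pow_nonneg h0 _)] at h
  refine (pow_le_pow_left₀ (norm_nonneg _) h 2).trans ?_
  nlinarith [sq_nonneg (r ^ latticeLength (b - a) - r ^ latticeLength b)]

theorem summable_displacement_bound (h0 : 0 ≤ r) (h1 : r < 1) (a : ℤ × ℤ) :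
    Summable fun b => 2 * (r ^ latticeLength (b - a)) ^ 2 + 2 * (r ^ latticeLength b) ^ 2 :=
  (((Equiv.subRight a).summable_iff.2 (summable_sq_pow_latticeLength h0 h1)).mul_left 2).add
    ((summable_sq_pow_latticeLength h0 h1).mul_left 2)

theorem summable_displacement (h0 : 0 ≤ r) (h1 : r < 1) (δ : ℝ) (a : ℤ × ℤ) :
    Summable fun b => ‖cocycle δ a b * ((r ^ latticeLength (b - a) : ℝ) : ℂ) -
      ((r ^ latticeLength b : ℝ) : ℂ)‖ ^ 2 :=
  Summable.of_nonneg_of_le (fun _ => sq_nonneg _) (displacement_term_le h0 δ a)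
    (summable_displacement_bound h0 h1 a)

theorem displacement_nonneg (δ r : ℝ) (a : ℤ × ℤ) : 0 ≤ displacement δ r a :=
  div_nonneg (tsum_nonneg fun _ => sq_nonneg _) (tsum_nonneg fun _ => sq_nonneg _)

theorem tsum_le_four_mul_tsum_of_le_add {α : Type*} {u v : α → ℝ} (e : α ≃ α) (x : α → ℝ)
    (hx : ∀ b, x b ≤ 2 * u b + 2 * v b) (hv : Summable v) (huv : ∀ b, u b = v (e b))
    (hxs : Summable x) : ∑' b, x b ≤ 4 * ∑' b, v b := by
  have hu : Summable u := by
    simp only [funext huv]; exact e.summable_iff.2 hv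
  have ht : ∑' b, u b = ∑' b, v b := by
    simp only [funext huv]; exact e.tsum_eq v
  have hle := hxs.tsum_le_tsum hx ((hu.mul_left 2).add (hv.mul_left 2))
  rw [(hu.mul_left 2).tsum_add (hv.mul_left 2), tsum_mul_left, tsum_mul_left, ht] at hle
  linarith

theorem displacement_le_four (h0 : 0 < r) (h1 : r < 1) (δ : ℝ) (a : ℤ × ℤ) :
    displacement δ r a ≤ 4 := by
  rw [displacement, div_le_iff₀ (tsum_sq_pow_latticeLength_pos h0 h1)]
  exact tsum_le_four_mul_tsum_of_le_add (Equiv.subRight a) _ (displacement_term_le h0.le δ a) 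
    (summable_sq_pow_latticeLength h0.le h1) (fun _ => rfl) (summable_displacement h0.le h1 δ a)

theorem sqrt_displacement_le (h0 : 0 < r) (h1 : r < 1) (δ : ℝ) (a : ℤ × ℤ) :
    √(displacement δ r a) ≤ 2 := by
  rw [Real.sqrt_le_left zero_le_two]
  exact (displacement_le_four h0 h1 δ a).trans (by norm_num)

theorem tendsto_displacement (h0 : 0 < r) (h1 : r < 1) (a : ℤ × ℤ) :
    Tendsto (fun δ => displacement δ r a) (𝓝 0) (𝓝 (displacement 0 r a)) := by
  refine Tendsto.div_const (tendsto_tsum_of_dominated_convergence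
    (summable_displacement_bound h0.le h1 a) (fun b => ?_)
    (Eventually.of_forall fun δ b => ?_)) _
  · exact Continuous.tendsto' ((((continuous_cocycle a b).mul continuous_const).sub
      continuous_const).norm.pow 2) _ _ rfl
  · rw [Real.norm_of_nonneg (sq_nonneg _)]
    exact displacement_term_le h0.le δ a b

/-- Translating the weight `b ↦ r ^ |b|` changes it by a small factor, pointwise: this makes its
almost invariance immediate, whereas indicator functions would require counting points. -/
theorem abs_pow_latticeLength_sub_le (h0 : 0 < r) (h1 : r < 1) (a b : ℤ × ℤ) :
    |r ^ latticeLength (b - a) - r ^ latticeLength b| ≤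
      ((r ^ latticeLength a)⁻¹ - 1) * r ^ latticeLength b := by
  have e1 : latticeLength (b - a) ≤ latticeLength b + latticeLength a := by
    simp only [latticeLength, Prod.fst_sub, Prod.snd_sub]; omega
  have e2 : latticeLength b ≤ latticeLength (b - a) + latticeLength a := by
    simp only [latticeLength, Prod.fst_sub, Prod.snd_sub]; omega
  have l1 := pow_le_pow_of_le_one h0.le h1.le e1
  have l2 := pow_le_pow_of_le_one h0.le h1.le e2
  rw [pow_add] at l1 l2
  set x := r ^ latticeLength a with hx
  have hx0 : 0 < x := pow_pos h0 _
  have hb : 0 < r ^ latticeLength b := pow_pos h0 _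
  have hxx : x * x⁻¹ = 1 := mul_inv_cancel₀ hx0.ne'
  have hx1 : 2 ≤ x + x⁻¹ := by
    nlinarith [sq_nonneg (x - 1), inv_pos.2 hx0]
  rw [abs_le]
  constructor
  · nlinarith
  · have : r ^ latticeLength (b - a) ≤ r ^ latticeLength b * x⁻¹ := by
      rw [← div_eq_mul_inv, le_div_iff₀ hx0]
      exact l2
    nlinarith

theorem sqrt_displacement_zero_le (h0 : 0 < r) (h1 : r < 1) (a : ℤ × ℤ) :
    √(displacement 0 r a) ≤ (r ^ latticeLength a)⁻¹ - 1 := by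
  have hx : 0 ≤ (r ^ latticeLength a)⁻¹ - 1 :=
    sub_nonneg.2 ((one_le_inv₀ (pow_pos h0 _)).2 (pow_le_one₀ h0.le h1.le))
  rw [Real.sqrt_le_left hx, displacement, div_le_iff₀ (tsum_sq_pow_latticeLength_pos h0 h1),
    ← tsum_mul_left]
  refine (summable_displacement h0.le h1 0 a).tsum_le_tsum (fun b => ?_)
    ((summable_sq_pow_latticeLength h0.le h1).mul_left _)
  rw [cocycle_zero_parameter, one_mul, ← Complex.ofReal_sub, Complex.norm_real, ← mul_pow]
  exact pow_le_pow_left₀ (norm_nonneg _) (abs_pow_latticeLength_sub_le h0 h1 a b) 2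

end

/-- The regular projective representations for small parameters have almost invariant vectors:
the weight `r ^ |b|` is chosen slowly varying first, and then the parameter small enough for the
cocycle to be close to `1` where the weight is concentrated. -/
theorem exists_sum_displacement_lt {f : ℤ × ℤ → ℂ} (hf : Summable fun a => ‖f a‖) {ε : ℝ}
    (hε : 0 < ε) : ∃ r : ℝ, 0 < r ∧ r < 1 ∧
      ∀ᶠ δ in 𝓝 (0 : ℝ), ∑' a, ‖f a‖ * √(displacement δ r a) < ε := by
  have hev : ∀ᶠ r in 𝓝[<] (1 : ℝ), 0 < r ∧ r < 1 :=
    (Ioo_mem_nhdsLT zero_lt_one : Set.Ioo (0 : ℝ) 1 ∈ 𝓝[<] (1 : ℝ))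
  have hbound : ∀ r : ℝ, 0 < r → r < 1 → ∀ δ a,
      ‖‖f a‖ * √(displacement δ r a)‖ ≤ ‖f a‖ * 2 := fun r h0 h1 δ a => by
    rw [Real.norm_of_nonneg (mul_nonneg (norm_nonneg _) (Real.sqrt_nonneg _))]
    exact mul_le_mul_of_nonneg_left (sqrt_displacement_le h0 h1 δ a) (norm_nonneg _)
  have h1 : Tendsto (fun r => ∑' a, ‖f a‖ * √(displacement 0 r a)) (𝓝[<] 1)
      (𝓝 (∑' a : ℤ × ℤ, ‖f a‖ * 0)) := by
    refine tendsto_tsum_of_dominated_convergence (hf.mul_right 2) (fun a => ?_)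
      (hev.mono fun r hr => hbound r hr.1 hr.2 0)
    refine Tendsto.const_mul _ (squeeze_zero' (Eventually.of_forall fun _ => Real.sqrt_nonneg _)
      (hev.mono fun r hr => sqrt_displacement_zero_le hr.1 hr.2 a) ?_)
    have hc : ContinuousAt (fun r : ℝ => (r ^ latticeLength a)⁻¹ - 1) 1 :=
      ((continuous_pow _).continuousAt.inv₀ (by simp)).sub continuousAt_const
    have ht := hc.tendsto
    simp only [one_pow, inv_one, sub_self] at ht
    exact ht.mono_left nhdsWithin_le_nhds
  simp only [mul_zero, tsum_zero] at h1
  obtain ⟨r, hr, hr0, hr1⟩ := ((h1.eventually (gt_mem_nhds hε)).and hev).exists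
  refine ⟨r, hr0, hr1, ?_⟩
  have h2 : Tendsto (fun δ => ∑' a, ‖f a‖ * √(displacement δ r a)) (𝓝 0)
      (𝓝 (∑' a, ‖f a‖ * √(displacement 0 r a))) :=
    tendsto_tsum_of_dominated_convergence (hf.mul_right 2)
      (fun a => ((tendsto_displacement hr0 hr1 a).sqrt).const_mul _)
      (Eventually.of_forall fun δ => hbound r hr0 hr1 δ)
  exact h2.eventually (gt_mem_nhds hr)

section

variable {H : Type} [NormedAddCommGroup H] [InnerProductSpace ℂ H]

/-- The elementary tensor of `b ↦ r ^ |b|` and `h` in `ℓ²(ℤ²) ⊗ H`. -/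
noncomputable def weightTensor {r : ℝ} (h0 : 0 < r) (h1 : r < 1) (h : H) : LatticeL2 H :=
  ⟨fun b => ((r ^ latticeLength b : ℝ) : ℂ) • h, memℓp_two_of_summable (by
    simp only [norm_smul, mul_pow, Complex.norm_real, norm_pow, Real.norm_of_nonneg h0.le]
    exact (summable_sq_pow_latticeLength h0.le h1).mul_right _)⟩

theorem norm_weightTensor {r : ℝ} (h0 : 0 < r) (h1 : r < 1) (h : H) :
    ‖weightTensor h0 h1 h‖ = √(∑' b, (r ^ latticeLength b) ^ 2) * ‖h‖ := by
  rw [← sq_eq_sq₀ (norm_nonneg _) (mul_nonneg (Real.sqrt_nonneg _) (norm_nonneg _)),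
    norm_sq_eq_tsum, mul_pow, Real.sq_sqrt (tsum_sq_pow_latticeLength_pos h0 h1).le,
    ← tsum_mul_right]
  refine tsum_congr fun b => ?_
  change ‖((r ^ latticeLength b : ℝ) : ℂ) • h‖ ^ 2 = _
  rw [norm_smul, mul_pow, Complex.norm_real, Real.norm_of_nonneg (pow_nonneg h0.le _)]

/-- `weightTensor` as a bounded linear map of the second factor. -/
noncomputable def weightTensorCLM {r : ℝ} (h0 : 0 < r) (h1 : r < 1) : H →L[ℂ] LatticeL2 H :=
  LinearMap.mkContinuous
    { toFun := weightTensor h0 h1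
      map_add' := fun h k => by
        ext b
        exact smul_add _ h k
      map_smul' := fun z h => by
        ext b
        exact smul_comm _ z h }
    (√(∑' b, (r ^ latticeLength b) ^ 2)) fun h => (norm_weightTensor h0 h1 h).le

theorem norm_regularTensor_weightTensor_sub [CompleteSpace H] {θ : ℝ}
    {U : ℤ × ℤ → H →L[ℂ] H} (hU : IsProjRep θ U) (δ : ℝ) {r : ℝ} (h0 : 0 < r)
    (h1 : r < 1) (a : ℤ × ℤ) (h : H) :
    ‖regularTensor hU δ a (weightTensor h0 h1 h) - weightTensor h0 h1 (U a h)‖ =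
      √(∑' b, (r ^ latticeLength b) ^ 2) * √(displacement δ r a) * ‖h‖ := by
  have hS := tsum_sq_pow_latticeLength_pos h0 h1
  rw [← sq_eq_sq₀ (norm_nonneg _) (by positivity), norm_sq_eq_tsum, mul_pow, mul_pow,
    Real.sq_sqrt hS.le, Real.sq_sqrt (displacement_nonneg _ _ _), displacement,
    mul_div_cancel₀ _ hS.ne', ← tsum_mul_right]
  refine tsum_congr fun b => ?_
  have hval : (regularTensor hU δ a (weightTensor h0 h1 h) - weightTensor h0 h1 (U a h)) b =
      (cocycle δ a b * ((r ^ latticeLength (b - a) : ℝ) : ℂ) - ((r ^ latticeLength b : ℝ) : ℂ)) •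
        U a h := by
    change cocycle δ a b • U a (((r ^ latticeLength (b - a) : ℝ) : ℂ) • h) -
      ((r ^ latticeLength b : ℝ) : ℂ) • U a h = _
    rw [map_smul, smul_smul, sub_smul]
  rw [hval, norm_smul, mul_pow, hU.norm_map]

/-- Comparison of the norms of two quantum tori, by testing the tensor product of a representation
for `θ` and the regular representation for `δ` on elementary tensors. -/
theorem torusNormReal_le_add_displacement (θ δ : ℝ) {f : ℤ × ℤ → ℂ}
    (hf : Summable fun a => ‖f a‖) {r : ℝ} (h0 : 0 < r) (h1 : r < 1) :
    torusNormReal θ f ≤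
      torusNormReal (θ + δ) f + ∑' a, ‖f a‖ * √(displacement δ r a) := by
  have hsum : Summable fun a => ‖f a‖ * √(displacement δ r a) :=
    Summable.of_nonneg_of_le (fun a => mul_nonneg (norm_nonneg _) (Real.sqrt_nonneg _))
      (fun a => mul_le_mul_of_nonneg_left (sqrt_displacement_le h0 h1 δ a) (norm_nonneg _))
      (hf.mul_right 2)
  have hD : 0 ≤ ∑' a, ‖f a‖ * √(displacement δ r a) :=
    tsum_nonneg fun a => mul_nonneg (norm_nonneg _) (Real.sqrt_nonneg _)
  refine torusNormReal_le (add_nonneg (torusNormReal_nonneg _ _) hD) fun H _ _ _ U hU => ?_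
  refine ContinuousLinearMap.opNorm_le_bound _ (add_nonneg (torusNormReal_nonneg _ _) hD)
    fun h => ?_
  have hW := isProjRep_regularTensor hU δ
  set S := ∑' b, (r ^ latticeLength b) ^ 2 with hSdef
  have hS : 0 < √S := Real.sqrt_pos.2 (tsum_sq_pow_latticeLength_pos h0 h1)
  set J : H →L[ℂ] LatticeL2 H := weightTensorCLM h0 h1 with hJ
  have hJa : ∀ k, J k = weightTensor h0 h1 k := fun _ => rfl
  have hsU := hU.summable_smul hf
  have hsW := hW.summable_smul hf
  have e1 : J ((∑' a, f a • U a) h) = ∑' a, f a • J (U a h) := by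
    rw [← ContinuousLinearMap.apply_apply h (∑' a, f a • U a), ContinuousLinearMap.map_tsum _ hsU,
      ContinuousLinearMap.map_tsum _ (hsU.mapL _)]
    simp
  have s1 : Summable fun a => f a • J (U a h) := by
    simpa using (hsU.mapL (ContinuousLinearMap.apply ℂ H h)).mapL J
  have e2 : (∑' a, f a • regularTensor hU δ a) (J h) = ∑' a, f a • regularTensor hU δ a (J h) := by
    rw [← ContinuousLinearMap.apply_apply (J h) (∑' a, f a • regularTensor hU δ a),
      ContinuousLinearMap.map_tsum _ hsW]
    simp
  have s2 : Summable fun a => f a • regularTensor hU δ a (J h) := by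
    simpa using hsW.mapL (ContinuousLinearMap.apply ℂ (LatticeL2 H) (J h))
  have e3 : ‖(∑' a, f a • regularTensor hU δ a) (J h) - J ((∑' a, f a • U a) h)‖ ≤
      (√S * ‖h‖) * ∑' a, ‖f a‖ * √(displacement δ r a) := by
    rw [e1, e2, ← s2.tsum_sub s1, ← tsum_mul_left]
    refine tsum_of_norm_bounded (hsum.mul_left _).hasSum fun a => ?_
    rw [← smul_sub, norm_smul, hJa, hJa, norm_regularTensor_weightTensor_sub]
    exact le_of_eq (by ring)
  have e4 : ‖(∑' a, f a • regularTensor hU δ a) (J h)‖ ≤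
      torusNormReal (θ + δ) f * (√S * ‖h‖) := by
    rw [hSdef, ← norm_weightTensor h0 h1 h]
    exact ContinuousLinearMap.le_of_opNorm_le _ (hW.norm_le_torusNormReal hf) _
  have e5 : √S * ‖(∑' a, f a • U a) h‖ = ‖J ((∑' a, f a • U a) h)‖ :=
    (norm_weightTensor h0 h1 _).symm
  have e6 := norm_le_norm_add_norm_sub (( ∑' a, f a • regularTensor hU δ a) (J h))
    (J ((∑' a, f a • U a) h))
  refine le_of_mul_le_mul_left ?_ hS
  rw [e5]
  refine (e6.trans (add_le_add e4 e3)).trans_eq ?_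
  ring

end

/-- The quantum tori form a continuous field: their norm is jointly continuous in the parameter and
in `f ∈ ℓ¹(ℤ²)`. -/
theorem tendsto_torusNormReal {ι : Type*} {l : Filter ι} {θ : ι → ℝ} {θ₀ : ℝ}
    (hθ : Tendsto θ l (𝓝 θ₀)) {f : ι → ℤ × ℤ → ℂ} {f₀ : ℤ × ℤ → ℂ}
    (hf : ∀ᶠ i in l, Summable fun a => ‖f i a‖) (hf₀ : Summable fun a => ‖f₀ a‖)
    (hff : Tendsto (fun i => ∑' a, ‖f i a - f₀ a‖) l (𝓝 0)) :
    Tendsto (fun i => torusNormReal (θ i) (f i)) l (𝓝 (torusNormReal θ₀ f₀)) := by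
  rw [Metric.tendsto_nhds]
  intro ε hε
  obtain ⟨r, h0, h1, hr⟩ := exists_sum_displacement_lt hf₀ (half_pos hε)
  have t1 : Tendsto (fun i => θ i - θ₀) l (𝓝 0) := by simpa using hθ.sub_const θ₀
  have t2 : Tendsto (fun i => θ₀ - θ i) l (𝓝 0) := by simpa using hθ.const_sub θ₀
  filter_upwards [hf, hff.eventually (gt_mem_nhds (half_pos hε)), t1.eventually hr,
    t2.eventually hr] with i hi hi1 hi2 hi3
  have a1 := torusNormReal_le_add_tsum (θ := θ i) hi hf₀
  have a2 := torusNormReal_le_add_tsum (θ := θ i) hf₀ hi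
  have a3 := torusNormReal_le_add_displacement θ₀ (θ i - θ₀) hf₀ h0 h1
  have a4 := torusNormReal_le_add_displacement (θ i) (θ₀ - θ i) hf₀ h0 h1
  simp only [norm_sub_rev (f₀ _)] at a2
  rw [add_sub_cancel] at a3 a4
  rw [Real.dist_eq, abs_lt]
  constructor <;> linarith

/-! ### The representation of `ℤ²` on Schwartz functions -/

/-- Powers of two elements of a group that commute up to a central factor. -/
theorem zpow_mul_zpow_of_commutator {G : Type*} [Group G] {u v z : G} (h : v * u = z * (u * v))
    (hu : Commute z u) (hv : Commute z v) (m n : ℤ) :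
    v ^ m * u ^ n = z ^ (m * n) * (u ^ n * v ^ m) := by
  have h1 : v * u * v⁻¹ = z * u := by rw [h, mul_assoc, mul_assoc, mul_inv_cancel, mul_one]
  have h2 : v * u ^ n * v⁻¹ = z ^ n * u ^ n := by
    rw [← conj_zpow, h1, hu.mul_zpow]
  have h3 : (u ^ n)⁻¹ * v * u ^ n = z ^ n * v := by
    have hc : (u ^ n)⁻¹ * z ^ n = z ^ n * (u ^ n)⁻¹ := ((hu.zpow_zpow n n).inv_right).eq.symm
    have : v * u ^ n = z ^ n * u ^ n * v := by rw [← h2]; group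
    rw [mul_assoc, this, ← mul_assoc, ← mul_assoc, hc]
    group
  have h4 : (u ^ n)⁻¹ * v ^ m * u ^ n = z ^ (n * m) * v ^ m := by
    have := conj_zpow (i := m) (a := (u ^ n)⁻¹) (b := v)
    rw [inv_inv] at this
    rw [← this, h3, (hv.zpow_left n).mul_zpow, zpow_mul]
  calc v ^ m * u ^ n = u ^ n * ((u ^ n)⁻¹ * v ^ m * u ^ n) := by group
    _ = u ^ n * (z ^ (n * m) * v ^ m) := by rw [h4]
    _ = z ^ (m * n) * (u ^ n * v ^ m) := by
      rw [← mul_assoc, ← ((hu.zpow_zpow (n * m) n).eq), mul_assoc, mul_comm n m]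

/-- Multiplication by `exp (2 i π r)` on `ℂ^d`. -/
noncomputable def scalarPhase (d : ℕ) (r : ℝ) : Cd d ≃ₗᵢ[ℂ] Cd d :=
  LinearIsometryEquiv.piLpCongrRight 2 fun _ : Fin d => phase r

theorem phase_apply (r : ℝ) (z : ℂ) :
    phase r z = Complex.exp (((2 * Real.pi * r : ℝ) : ℂ) * Complex.I) * z := rfl

theorem scalarPhase_apply (d : ℕ) (r : ℝ) (w : Cd d) :
    scalarPhase d r w = Complex.exp (((2 * Real.pi * r : ℝ) : ℂ) * Complex.I) • w := by
  ext j
  simp [scalarPhase, phase_apply]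

theorem scalarPhase_mul (d : ℕ) (r t : ℝ) :
    scalarPhase d r * scalarPhase d t = scalarPhase d (r + t) := by
  ext1 w
  change scalarPhase d r (scalarPhase d t w) = _
  rw [scalarPhase_apply, scalarPhase_apply, scalarPhase_apply, smul_smul, ← Complex.exp_add]
  congr 2
  push_cast
  ring

theorem scalarPhase_zpow (d : ℕ) (r : ℝ) (k : ℤ) :
    scalarPhase d r ^ k = scalarPhase d (k * r) := by
  have h0 : scalarPhase d 0 = 1 := by
    ext1 w
    rw [scalarPhase_apply]
    simp
  have hinv : (scalarPhase d r)⁻¹ = scalarPhase d (-r) := by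
    rw [inv_eq_iff_mul_eq_one, scalarPhase_mul, add_neg_cancel, h0]
  induction k with
  | zero => rw [zpow_zero, Int.cast_zero, zero_mul, h0]
  | succ n ih =>
    rw [zpow_add_one, ih, scalarPhase_mul]
    congr 1
    push_cast
    ring
  | pred n ih =>
    rw [zpow_sub_one, ih, hinv, scalarPhase_mul]
    congr 1
    push_cast
    ring

theorem scalarPhase_commute (d : ℕ) (r : ℝ) (T : Cd d ≃ₗᵢ[ℂ] Cd d) :
    Commute (scalarPhase d r) T := by
  ext1 w
  change scalarPhase d r (T w) = T (scalarPhase d r w)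
  rw [scalarPhase_apply, scalarPhase_apply, map_smul]

/-- The commutation relation of the clock and the shift. It uses that `q` divides `d`: going once
around the cycle multiplies the eigenvalue of the clock by `exp (2 i π p d / q) = 1`. -/
theorem clock_mul_shift (p : ℤ) {q d : ℕ} (hq : 0 < q) (hqd : q ∣ d) :
    clock p q d * shift d = scalarPhase d (p / q) * (shift d * clock p q d) := by
  have hq' : (q : ℝ) ≠ 0 := Nat.cast_ne_zero.2 hq.ne'
  ext1 w
  change clock p q d (shift d w) = scalarPhase d (p / q) (shift d (clock p q d w))
  rw [scalarPhase_apply]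
  ext j
  obtain ⟨k, rfl⟩ := (finRotate d).surjective j
  simp only [clock, shift, LinearIsometryEquiv.piLpCongrRight_apply,
    LinearIsometryEquiv.piLpCongrLeft_apply, PiLp.smul_apply, phase_apply,
    Equiv.piCongrLeft'_apply, Equiv.symm_apply_apply, smul_eq_mul]
  rw [← mul_assoc, ← Complex.exp_add]
  congr 1
  obtain ⟨n, rfl⟩ : ∃ n, d = n + 1 := ⟨d - 1, by have := k.2; omega⟩
  by_cases hk : k = Fin.last n
  · subst hk
    obtain ⟨e, he⟩ := hqd
    rw [finRotate_last, Complex.exp_eq_exp_iff_exists_int]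
    refine ⟨-(p * e), ?_⟩
    have he' : (n : ℂ) + 1 = q * e := by exact_mod_cast congrArg (Nat.cast : ℕ → ℂ) he
    have hn : (n : ℂ) = q * e - 1 := by rw [← he']; ring
    have hqc : (q : ℂ) ≠ 0 := by exact_mod_cast hq.ne'
    simp only [Fin.val_zero, Fin.val_last]
    push_cast
    rw [hn]
    field_simp
    ring
  · rw [coe_finRotate_of_ne_last hk]
    congr 1
    push_cast
    field_simp
    ring

/-- The finite-dimensional part of `latticeRep`. -/
noncomputable def finiteWeyl (p : ℤ) (q d : ℕ) (a : ℤ × ℤ) : Cd d ≃ₗᵢ[ℂ] Cd d :=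
  shift d ^ a.1 * clock p q d ^ a.2

/-- `finiteWeyl` is projective: the exponential of the commutator is the part of the cocycle that
comes from `p / q`. -/
theorem finiteWeyl_inv_mul (p : ℤ) {q d : ℕ} (hq : 0 < q) (hqd : q ∣ d) (a b : ℤ × ℤ) :
    (finiteWeyl p q d b)⁻¹ * finiteWeyl p q d a =
      scalarPhase d (((-b.2 * (a.1 - b.1) : ℤ) : ℝ) * (p / q)) * finiteWeyl p q d (a - b) := by
  have h := zpow_mul_zpow_of_commutator (clock_mul_shift p hq hqd)
    (scalarPhase_commute d (p / q) _) (scalarPhase_commute d (p / q) _) (-b.2) (a.1 - b.1)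
  rw [← scalarPhase_zpow]
  calc (finiteWeyl p q d b)⁻¹ * finiteWeyl p q d a =
      (clock p q d ^ (-b.2) * shift d ^ (a.1 - b.1)) * clock p q d ^ a.2 := by
        rw [finiteWeyl, finiteWeyl]; group
    _ = _ := by
        rw [h, finiteWeyl, Prod.fst_sub, Prod.snd_sub]; group

section

variable {p : ℤ} {q d : ℕ} {θ : ℝ}

theorem latticeRep_apply (p : ℤ) (q d : ℕ) (θ : ℝ) (a : ℤ × ℤ) (ξ : 𝓢(ℝ, Cd d)) (s : ℝ) :
    latticeRep p q d θ a ξ s =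
      Complex.exp (((Real.pi * (θ * a.1 * a.2 + 2 * s * a.1) : ℝ) : ℂ) * Complex.I) •
        finiteWeyl p q d a (ξ (s + (θ - p / q) * a.2)) := by
  have h : latticeRep p q d θ a ξ s = Complex.exp (Complex.I * Real.pi * p * a.1 * a.2 / q) •
      finiteWeyl p q d a (schrodinger (θ - p / q) a.1 a.2 ξ s) := rfl
  rw [h, schrodinger, heisRep_apply, map_smul, smul_smul, ← Complex.exp_add]
  congr 2
  push_cast
  ring

theorem norm_latticeRep_apply (a : ℤ × ℤ) (ξ : 𝓢(ℝ, Cd d)) (s : ℝ) :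
    ‖latticeRep p q d θ a ξ s‖ = ‖ξ (s + (θ - p / q) * a.2)‖ := by
  rw [latticeRep_apply, norm_smul, Complex.norm_exp_ofReal_mul_I, one_mul,
    LinearIsometryEquiv.norm_map]

theorem latticeRep_add (a : ℤ × ℤ) (ξ η : 𝓢(ℝ, Cd d)) :
    latticeRep p q d θ a (ξ + η) = latticeRep p q d θ a ξ + latticeRep p q d θ a η := by
  ext1 s
  simp only [latticeRep_apply, add_apply, map_add, smul_add]

theorem latticeRep_smul (a : ℤ × ℤ) (c : ℂ) (ξ : 𝓢(ℝ, Cd d)) :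
    latticeRep p q d θ a (c • ξ) = c • latticeRep p q d θ a ξ := by
  ext1 s
  simp only [latticeRep_apply, smul_apply, map_smul]
  rw [smul_comm]

/-- The derivative of a Schwartz function of a real variable. -/
noncomputable abbrev derivS (ξ : 𝓢(ℝ, Cd d)) : 𝓢(ℝ, Cd d) := SchwartzMap.derivCLM ℂ (Cd d) ξ

theorem hasDerivAt_derivS (ξ : 𝓢(ℝ, Cd d)) (s : ℝ) : HasDerivAt ξ (derivS ξ s) s := by
  rw [SchwartzMap.derivCLM_apply]
  exact ξ.hasDerivAt s

theorem derivS_latticeRep (a : ℤ × ℤ) (ξ : 𝓢(ℝ, Cd d)) :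
    derivS (latticeRep p q d θ a ξ) =
      (2 * Real.pi * a.1 * Complex.I : ℂ) • latticeRep p q d θ a ξ +
        latticeRep p q d θ a (derivS ξ) := by
  ext1 s
  have h1 : HasDerivAt (fun s : ℝ =>
      Complex.exp (((Real.pi * (θ * a.1 * a.2 + 2 * s * a.1) : ℝ) : ℂ) * Complex.I))
      (Complex.exp (((Real.pi * (θ * a.1 * a.2 + 2 * s * a.1) : ℝ) : ℂ) * Complex.I) *
        (2 * Real.pi * a.1 * Complex.I)) s := by
    have h : HasDerivAt (fun s : ℝ => Real.pi * (θ * a.1 * a.2 + 2 * s * a.1))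
        (Real.pi * (2 * 1 * a.1)) s :=
      ((((hasDerivAt_id s).const_mul 2).mul_const (a.1 : ℝ)).const_add _).const_mul _
    have h' := (h.ofReal_comp.mul_const Complex.I).cexp
    convert h' using 1
    push_cast
    ring
  have h2 : HasDerivAt (fun s : ℝ => finiteWeyl p q d a (ξ (s + (θ - p / q) * a.2)))
      (finiteWeyl p q d a (derivS ξ (s + (θ - p / q) * a.2))) s :=
    ((finiteWeyl p q d a).toContinuousLinearEquiv.toContinuousLinearMap.restrictScalars ℝ
      ).hasFDerivAt.comp_hasDerivAt s
      ((hasDerivAt_derivS ξ (s + (θ - p / q) * a.2)).comp_add_const s _)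
  have h3 := h1.smul h2
  have h4 : (fun s : ℝ =>
      Complex.exp (((Real.pi * (θ * a.1 * a.2 + 2 * s * a.1) : ℝ) : ℂ) * Complex.I)) •
      (fun s : ℝ => finiteWeyl p q d a (ξ (s + (θ - p / q) * a.2))) =
      (latticeRep p q d θ a ξ : ℝ → Cd d) := by
    funext s
    rw [latticeRep_apply]
    rfl
  have h5 := (hasDerivAt_derivS (latticeRep p q d θ a ξ) s).unique (h4 ▸ h3)
  rw [h5, add_apply, smul_apply, latticeRep_apply, latticeRep_apply, smul_smul, add_comm,
    mul_comm (2 * _ * _ * _)]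

end

section

variable {p : ℤ} {q d : ℕ} {θ : ℝ}

/-! ### Decay of the inner products -/

/-- `ξ` is bounded by `B (1 + s²)⁻²`. -/
def HasDecay (B : ℝ) (ξ : 𝓢(ℝ, Cd d)) : Prop := ∀ s : ℝ, (1 + s ^ 2) ^ 2 * ‖ξ s‖ ≤ B

/-- `ξ` and its first two derivatives are bounded by `B (1 + s²)⁻²`. -/
def HasDecay₂ (B : ℝ) (ξ : 𝓢(ℝ, Cd d)) : Prop :=
  HasDecay B ξ ∧ HasDecay B (derivS ξ) ∧ HasDecay B (derivS (derivS ξ))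

theorem HasDecay.nonneg {B : ℝ} {ξ : 𝓢(ℝ, Cd d)} (h : HasDecay B ξ) : 0 ≤ B :=
  (by positivity : (0 : ℝ) ≤ (1 + (0 : ℝ) ^ 2) ^ 2 * ‖ξ 0‖).trans (h 0)

theorem HasDecay.mono {B B' : ℝ} {ξ : 𝓢(ℝ, Cd d)} (h : HasDecay B ξ) (hB : B ≤ B') :
    HasDecay B' ξ := fun s => (h s).trans hB

theorem HasDecay₂.mono {B B' : ℝ} {ξ : 𝓢(ℝ, Cd d)} (h : HasDecay₂ B ξ) (hB : B ≤ B') :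
    HasDecay₂ B' ξ := ⟨h.1.mono hB, h.2.1.mono hB, h.2.2.mono hB⟩

theorem HasDecay.add {A B : ℝ} {ξ η : 𝓢(ℝ, Cd d)} (hξ : HasDecay A ξ) (hη : HasDecay B η) :
    HasDecay (A + B) (ξ + η) := fun s => by
  have h := mul_le_mul_of_nonneg_left (norm_add_le (ξ s) (η s)) (sq_nonneg (1 + s ^ 2))
  rw [add_apply]
  linarith [hξ s, hη s, mul_add ((1 + s ^ 2) ^ 2) ‖ξ s‖ ‖η s‖]

theorem HasDecay.smul {B : ℝ} {ξ : 𝓢(ℝ, Cd d)} (hξ : HasDecay B ξ) (c : ℂ) :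
    HasDecay (‖c‖ * B) (c • ξ) := fun s => by
  rw [smul_apply, norm_smul, mul_left_comm]
  exact mul_le_mul_of_nonneg_left (hξ s) (norm_nonneg c)

theorem HasDecay₂.add {A B : ℝ} {ξ η : 𝓢(ℝ, Cd d)} (hξ : HasDecay₂ A ξ) (hη : HasDecay₂ B η) :
    HasDecay₂ (A + B) (ξ + η) := by
  refine ⟨hξ.1.add hη.1, ?_, ?_⟩
  · rw [derivS, map_add]
    exact hξ.2.1.add hη.2.1
  · rw [derivS, derivS, map_add, map_add]
    exact hξ.2.2.add hη.2.2

theorem HasDecay₂.smul {B : ℝ} {ξ : 𝓢(ℝ, Cd d)} (hξ : HasDecay₂ B ξ) (c : ℂ) :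
    HasDecay₂ (‖c‖ * B) (c • ξ) := by
  refine ⟨hξ.1.smul c, ?_, ?_⟩
  · rw [derivS, map_smul]
    exact hξ.2.1.smul c
  · rw [derivS, derivS, map_smul, map_smul]
    exact hξ.2.2.smul c

theorem exists_hasDecay (ξ : 𝓢(ℝ, Cd d)) : ∃ B, HasDecay B ξ := by
  obtain ⟨C0, _, h0⟩ := ξ.decay 0 0
  obtain ⟨C2, _, h2⟩ := ξ.decay 2 0
  obtain ⟨C4, _, h4⟩ := ξ.decay 4 0
  refine ⟨C0 + 2 * C2 + C4, fun s => ?_⟩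
  have e0 := h0 s
  have e2 := h2 s
  have e4 := h4 s
  rw [norm_iteratedFDeriv_zero, Real.norm_eq_abs] at e0 e2 e4
  rw [sq_abs] at e2
  rw [show |s| ^ 4 = s ^ 4 by rw [show 4 = 2 * 2 by rfl, pow_mul, sq_abs, ← pow_mul]] at e4
  linarith [show (1 + s ^ 2) ^ 2 * ‖ξ s‖ = s ^ 4 * ‖ξ s‖ + 2 * (s ^ 2 * ‖ξ s‖) + |s| ^ 0 * ‖ξ s‖ by
    ring]

theorem exists_hasDecay₂ (ξ : 𝓢(ℝ, Cd d)) : ∃ B, HasDecay₂ B ξ := by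
  obtain ⟨B0, h0⟩ := exists_hasDecay ξ
  obtain ⟨B1, h1⟩ := exists_hasDecay (derivS ξ)
  obtain ⟨B2, h2⟩ := exists_hasDecay (derivS (derivS ξ))
  exact ⟨max B0 (max B1 B2), h0.mono (le_max_left _ _),
    h1.mono ((le_max_left _ _).trans (le_max_right _ _)),
    h2.mono ((le_max_right _ _).trans (le_max_right _ _))⟩

/-- Peetre's inequality. -/
theorem one_add_sq_le_mul (s t : ℝ) : 1 + t ^ 2 ≤ 2 * (1 + s ^ 2) * (1 + (s + t) ^ 2) := by
  nlinarith [sq_nonneg (2 * s + t), sq_nonneg (s * (s + t)), sq_nonneg s, sq_nonneg (s + t)]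

theorem norm_inner_latticeRep_le {A B : ℝ} {ξ ω : 𝓢(ℝ, Cd d)} (hξ : HasDecay A ξ)
    (hω : HasDecay B ω) (a : ℤ × ℤ) (s : ℝ) :
    ‖inner ℂ (ω s) (latticeRep p q d θ a ξ s)‖ ≤
      2 * A * B * (1 + ((θ - p / q) * a.2) ^ 2)⁻¹ * (1 + s ^ 2)⁻¹ := by
  refine (norm_inner_le_norm _ _).trans ?_
  rw [norm_latticeRep_apply]
  set t := (θ - p / q) * a.2
  have h1 := hω s
  have h2 := hξ (s + t)
  have h3 := one_add_sq_le_mul s t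
  have hA := hξ.nonneg
  have hB := hω.nonneg
  have ps : 0 < 1 + s ^ 2 := by positivity
  have pst : 1 ≤ 1 + (s + t) ^ 2 := by nlinarith [sq_nonneg (s + t)]
  have pt : 0 < 1 + t ^ 2 := by positivity
  rw [← div_eq_mul_inv, ← div_eq_mul_inv, div_div, le_div_iff₀ (by positivity)]
  calc ‖ω s‖ * ‖ξ (s + t)‖ * ((1 + t ^ 2) * (1 + s ^ 2))
      ≤ ‖ω s‖ * ‖ξ (s + t)‖ * ((2 * (1 + s ^ 2) * (1 + (s + t) ^ 2)) * (1 + s ^ 2)) := by gcongr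
    _ = 2 * (((1 + s ^ 2) ^ 2 * ‖ω s‖) * ((1 + (s + t) ^ 2) * ‖ξ (s + t)‖)) := by ring
    _ ≤ 2 * (((1 + s ^ 2) ^ 2 * ‖ω s‖) * ((1 + (s + t) ^ 2) ^ 2 * ‖ξ (s + t)‖)) := by
        gcongr
        exact le_self_pow₀ pst two_ne_zero
    _ ≤ 2 * (B * A) := by gcongr
    _ = 2 * A * B := by ring

theorem continuous_inner_latticeRep (ξ ω : 𝓢(ℝ, Cd d)) (a : ℤ × ℤ) :
    Continuous fun s => inner ℂ (ω s) (latticeRep p q d θ a ξ s) :=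
  ω.continuous.inner (latticeRep p q d θ a ξ).continuous

theorem integrable_inner_latticeRep (ξ ω : 𝓢(ℝ, Cd d)) (a : ℤ × ℤ) :
    Integrable fun s => inner ℂ (ω s) (latticeRep p q d θ a ξ s) := by
  obtain ⟨A, hA⟩ := exists_hasDecay ξ
  obtain ⟨B, hB⟩ := exists_hasDecay ω
  exact (integrable_inv_one_add_sq.const_mul _).mono'
    (continuous_inner_latticeRep ξ ω a).aestronglyMeasurable
    (Eventually.of_forall (norm_inner_latticeRep_le hA hB a))

theorem norm_moduleInner_le_snd {A B : ℝ} {ξ ω : 𝓢(ℝ, Cd d)} (hξ : HasDecay A ξ)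
    (hω : HasDecay B ω) (a : ℤ × ℤ) :
    ‖moduleInner p q d θ ξ ω a‖ ≤ 2 * Real.pi * A * B * (1 + ((θ - p / q) * a.2) ^ 2)⁻¹ := by
  refine (norm_integral_le_of_norm_le (integrable_inv_one_add_sq.const_mul _)
    (Eventually.of_forall (norm_inner_latticeRep_le hξ hω a))).trans_eq ?_
  rw [integral_const_mul, integral_univ_inv_one_add_sq]
  ring

theorem moduleInner_add_left (ξ η ω : 𝓢(ℝ, Cd d)) (a : ℤ × ℤ) :
    moduleInner p q d θ (ξ + η) ω a = moduleInner p q d θ ξ ω a + moduleInner p q d θ η ω a := by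
  rw [moduleInner, moduleInner, moduleInner,
    ← integral_add (integrable_inner_latticeRep ξ ω a) (integrable_inner_latticeRep η ω a)]
  simp only [latticeRep_add, add_apply, inner_add_right]

theorem moduleInner_add_right (ξ ω η : 𝓢(ℝ, Cd d)) (a : ℤ × ℤ) :
    moduleInner p q d θ ξ (ω + η) a = moduleInner p q d θ ξ ω a + moduleInner p q d θ ξ η a := by
  rw [moduleInner, moduleInner, moduleInner,
    ← integral_add (integrable_inner_latticeRep ξ ω a) (integrable_inner_latticeRep ξ η a)]
  simp only [add_apply, inner_add_left]

theorem moduleInner_smul_left (c : ℂ) (ξ ω : 𝓢(ℝ, Cd d)) (a : ℤ × ℤ) :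
    moduleInner p q d θ (c • ξ) ω a = c * moduleInner p q d θ ξ ω a := by
  rw [moduleInner, moduleInner, ← integral_const_mul]
  simp only [latticeRep_smul, smul_apply, inner_smul_right]

theorem moduleInner_smul_right (c : ℂ) (ξ ω : 𝓢(ℝ, Cd d)) (a : ℤ × ℤ) :
    moduleInner p q d θ ξ (c • ω) a = starRingEnd ℂ c * moduleInner p q d θ ξ ω a := by
  rw [moduleInner, moduleInner, ← integral_const_mul]
  simp only [smul_apply, inner_smul_left]

/-- Integration by parts: the decay of the inner product in the first variable of `ℤ²`. -/
theorem mul_moduleInner_eq (ξ ω : 𝓢(ℝ, Cd d)) (a : ℤ × ℤ) :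
    (2 * Real.pi * a.1 * Complex.I : ℂ) * moduleInner p q d θ ξ ω a =
      -(moduleInner p q d θ ξ (derivS ω) a + moduleInner p q d θ (derivS ξ) ω a) := by
  have hparts : ∫ s : ℝ, inner ℂ (ω s) (derivS (latticeRep p q d θ a ξ) s) =
      -∫ s : ℝ, inner ℂ (derivS ω s) (latticeRep p q d θ a ξ s) :=
    SchwartzMap.integral_bilinear_deriv_right_eq_neg_left ω (latticeRep p q d θ a ξ)
      (isBoundedBilinearMap_inner (𝕜 := ℂ) (E := Cd d)).toContinuousLinearMap
  have hsplit : ∫ s : ℝ, inner ℂ (ω s) (derivS (latticeRep p q d θ a ξ) s) =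
      (2 * Real.pi * a.1 * Complex.I : ℂ) * moduleInner p q d θ ξ ω a +
        moduleInner p q d θ (derivS ξ) ω a := by
    rw [derivS_latticeRep, moduleInner, moduleInner, ← integral_const_mul,
      ← integral_add ((integrable_inner_latticeRep ξ ω a).const_mul _)
        (integrable_inner_latticeRep (derivS ξ) ω a)]
    simp only [add_apply, smul_apply, inner_add_right, inner_smul_right]
  have h : (2 * Real.pi * a.1 * Complex.I : ℂ) * moduleInner p q d θ ξ ω a +
      moduleInner p q d θ (derivS ξ) ω a = -moduleInner p q d θ ξ (derivS ω) a := by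
    rw [← hsplit, hparts]
    rfl
  rw [neg_add, ← h]
  ring

/-- Two integrations by parts give the decay in the first variable, where the four terms of the
Leibniz rule for the second derivative account for the constant. -/
theorem norm_moduleInner_le {A B : ℝ} {ξ ω : 𝓢(ℝ, Cd d)} (hξ : HasDecay₂ A ξ)
    (hω : HasDecay₂ B ω) (a : ℤ × ℤ) :
    ‖moduleInner p q d θ ξ ω a‖ ≤
      10 * Real.pi * A * B * ((1 + (a.1 : ℝ) ^ 2)⁻¹ * (1 + ((θ - p / q) * a.2) ^ 2)⁻¹) := by
  set K := 2 * Real.pi * A * B * (1 + ((θ - p / q) * a.2) ^ 2)⁻¹ with hK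
  have h00 := norm_moduleInner_le_snd (p := p) (q := q) (θ := θ) hξ.1 hω.1 a
  have h11 := norm_moduleInner_le_snd (p := p) (q := q) (θ := θ) hξ.2.1 hω.2.1 a
  have h20 := norm_moduleInner_le_snd (p := p) (q := q) (θ := θ) hξ.2.2 hω.1 a
  have h02 := norm_moduleInner_le_snd (p := p) (q := q) (θ := θ) hξ.1 hω.2.2 a
  have e : (2 * Real.pi * a.1 * Complex.I : ℂ) ^ 2 * moduleInner p q d θ ξ ω a =
      moduleInner p q d θ ξ (derivS (derivS ω)) a + moduleInner p q d θ (derivS ξ) (derivS ω) a +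
        (moduleInner p q d θ (derivS ξ) (derivS ω) a +
          moduleInner p q d θ (derivS (derivS ξ)) ω a) := by
    rw [sq, mul_assoc, mul_moduleInner_eq, mul_neg, mul_add, mul_moduleInner_eq,
      mul_moduleInner_eq]
    ring
  have n1 : ‖(2 * Real.pi * a.1 * Complex.I : ℂ) ^ 2‖ = 4 * Real.pi ^ 2 * (a.1 : ℝ) ^ 2 := by
    rw [norm_pow, norm_mul, Complex.norm_I, mul_one,
      show (2 * Real.pi * a.1 : ℂ) = ((2 * Real.pi * a.1 : ℝ) : ℂ) by push_cast; ring,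
      Complex.norm_real, Real.norm_eq_abs, sq_abs]
    ring
  have n2 : 4 * Real.pi ^ 2 * (a.1 : ℝ) ^ 2 * ‖moduleInner p q d θ ξ ω a‖ ≤ 4 * K := by
    rw [← n1, ← norm_mul, e]
    refine (norm_add_le _ _).trans ?_
    linarith [norm_add_le (moduleInner p q d θ ξ (derivS (derivS ω)) a)
      (moduleInner p q d θ (derivS ξ) (derivS ω) a),
      norm_add_le (moduleInner p q d θ (derivS ξ) (derivS ω) a)
      (moduleInner p q d θ (derivS (derivS ξ)) ω a)]
  have hpi : (1 : ℝ) ≤ 4 * Real.pi ^ 2 := by nlinarith [Real.pi_gt_three]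
  have n3 : (a.1 : ℝ) ^ 2 * ‖moduleInner p q d θ ξ ω a‖ ≤
      4 * Real.pi ^ 2 * (a.1 : ℝ) ^ 2 * ‖moduleInner p q d θ ξ ω a‖ := by
    rw [mul_assoc (4 * Real.pi ^ 2)]
    exact le_mul_of_one_le_left (by positivity) hpi
  have n4 : (1 + (a.1 : ℝ) ^ 2) * ‖moduleInner p q d θ ξ ω a‖ ≤ 5 * K := by linarith
  rw [mul_comm, ← le_div_iff₀ (by positivity)] at n4
  refine n4.trans_eq ?_
  rw [hK]
  ring

theorem summable_inv_one_add_int_sq : Summable fun n : ℤ => (1 + (n : ℝ) ^ 2)⁻¹ := by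
  refine Summable.of_norm_bounded_eventually (Real.summable_one_div_int_pow.2 one_lt_two) ?_
  filter_upwards [(Set.finite_singleton (0 : ℤ)).compl_mem_cofinite] with n hn
  have hn' : (0 : ℝ) < (n : ℝ) ^ 2 := by
    have : (n : ℝ) ≠ 0 := by simpa using hn
    positivity
  rw [Real.norm_of_nonneg (by positivity), one_div]
  exact inv_anti₀ hn' (by linarith)

/-- The function on `ℤ²` dominating all inner products. -/
noncomputable def latticeMajorant (a : ℤ × ℤ) : ℝ :=
  (1 + (a.1 : ℝ) ^ 2)⁻¹ * (1 + (a.2 : ℝ) ^ 2)⁻¹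

theorem summable_latticeMajorant : Summable latticeMajorant :=
  summable_inv_one_add_int_sq.mul_of_nonneg summable_inv_one_add_int_sq
    (fun _ => by positivity) fun _ => by positivity

/-- A bound for the inner products that is locally uniform in `θ ≠ p / q`. -/
theorem norm_moduleInner_le_latticeMajorant {A B δ : ℝ} {ξ ω : 𝓢(ℝ, Cd d)} (hξ : HasDecay₂ A ξ)
    (hω : HasDecay₂ B ω) (hδ : 0 < δ) (hθ : δ ≤ |θ - p / q|) (a : ℤ × ℤ) :
    ‖moduleInner p q d θ ξ ω a‖ ≤
      10 * Real.pi * A * B * (1 + (δ ^ 2)⁻¹) * latticeMajorant a := by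
  refine (norm_moduleInner_le hξ hω a).trans ?_
  have hA := hξ.1.nonneg
  have hB := hω.1.nonneg
  have h : (1 + ((θ - p / q) * a.2) ^ 2)⁻¹ ≤ (1 + (δ ^ 2)⁻¹) * (1 + (a.2 : ℝ) ^ 2)⁻¹ := by
    rw [← div_eq_mul_inv, le_div_iff₀ (by positivity), mul_comm, ← div_eq_mul_inv,
      div_le_iff₀ (by positivity), mul_pow]
    have h1 : δ ^ 2 ≤ (θ - p / q) ^ 2 := by
      rw [← sq_abs (θ - p / q)]
      exact pow_le_pow_left₀ hδ.le hθ 2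
    have h2 : δ ^ 2 * (a.2 : ℝ) ^ 2 ≤ (θ - p / q) ^ 2 * (a.2 : ℝ) ^ 2 :=
      mul_le_mul_of_nonneg_right h1 (sq_nonneg _)
    have h3 : (δ ^ 2)⁻¹ * (δ ^ 2 * (a.2 : ℝ) ^ 2) = (a.2 : ℝ) ^ 2 := by
      rw [← mul_assoc, inv_mul_cancel₀ (by positivity), one_mul]
    have h4 : (δ ^ 2)⁻¹ * (δ ^ 2 * (a.2 : ℝ) ^ 2) ≤
      (δ ^ 2)⁻¹ * ((θ - p / q) ^ 2 * (a.2 : ℝ) ^ 2) := mul_le_mul_of_nonneg_left h2 (by positivity)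
    have h5 : 0 ≤ (δ ^ 2)⁻¹ := by positivity
    nlinarith [mul_nonneg (sq_nonneg (θ - p / q)) (sq_nonneg (a.2 : ℝ))]
  rw [latticeMajorant, mul_assoc _ (1 + (δ ^ 2)⁻¹), mul_left_comm (1 + (δ ^ 2)⁻¹)]
  gcongr

theorem summable_moduleInner (hθ : θ ≠ p / q) (ξ ω : 𝓢(ℝ, Cd d)) :
    Summable fun a => ‖moduleInner p q d θ ξ ω a‖ := by
  obtain ⟨A, hA⟩ := exists_hasDecay₂ ξ
  obtain ⟨B, hB⟩ := exists_hasDecay₂ ω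
  exact Summable.of_nonneg_of_le (fun _ => norm_nonneg _)
    (norm_moduleInner_le_latticeMajorant hA hB (abs_pos.2 (sub_ne_zero.2 hθ)) le_rfl)
    (summable_latticeMajorant.mul_left _)

end

/-! ### Positivity of the inner product -/

section Averaging

open scoped ComplexOrder

theorem card_filter_translate (L : ℕ) (k : ℤ) :
    (L : ℤ) - k.natAbs ≤
        ((Finset.Ico (0 : ℤ) L).filter fun x => x + k ∈ Finset.Ico (0 : ℤ) L).card ∧
      ((Finset.Ico (0 : ℤ) L).filter fun x => x + k ∈ Finset.Ico (0 : ℤ) L).card ≤ L := by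
  have h : ((Finset.Ico (0 : ℤ) L).filter fun x => x + k ∈ Finset.Ico (0 : ℤ) L) =
      Finset.Ico (max 0 (-k)) (min (L : ℤ) (L - k)) := by
    ext x
    simp only [Finset.mem_filter, Finset.mem_Ico]
    omega
  rw [h, Int.card_Ico]
  omega

/-- The square `{0, …, L - 1}²` in `ℤ²`. -/
noncomputable def latticeBox (L : ℕ) : Finset (ℤ × ℤ) :=
  Finset.Ico (0 : ℤ) L ×ˢ Finset.Ico (0 : ℤ) L

/-- The proportion of the points of `latticeBox L` that the translation by `c` leaves in it. -/
noncomputable def overlap (L : ℕ) (c : ℤ × ℤ) : ℝ :=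
  ((latticeBox L).filter fun b => c + b ∈ latticeBox L).card / (L : ℝ) ^ 2

theorem overlap_eq (L : ℕ) (c : ℤ × ℤ) : overlap L c =
    (((Finset.Ico (0 : ℤ) L).filter fun x => x + c.1 ∈ Finset.Ico (0 : ℤ) L).card / (L : ℝ)) *
      (((Finset.Ico (0 : ℤ) L).filter fun x => x + c.2 ∈ Finset.Ico (0 : ℤ) L).card / (L : ℝ)) := by
  have h : ((latticeBox L).filter fun b => c + b ∈ latticeBox L) =
      ((Finset.Ico (0 : ℤ) L).filter fun x => x + c.1 ∈ Finset.Ico (0 : ℤ) L) ×ˢ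
        ((Finset.Ico (0 : ℤ) L).filter fun x => x + c.2 ∈ Finset.Ico (0 : ℤ) L) := by
    rw [← Finset.filter_product]
    refine Finset.filter_congr fun b _ => ?_
    simp only [latticeBox, Finset.mem_product, Prod.fst_add, Prod.snd_add, add_comm]
  rw [overlap, h, Finset.card_product, Nat.cast_mul, sq, mul_div_mul_comm]

theorem tendsto_card_filter_translate (k : ℤ) : Tendsto (fun L : ℕ =>
    ((Finset.Ico (0 : ℤ) L).filter fun x => x + k ∈ Finset.Ico (0 : ℤ) L).card / (L : ℝ))
    atTop (𝓝 1) := by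
  have h0 : Tendsto (fun L : ℕ => 1 - (k.natAbs : ℝ) / L) atTop (𝓝 1) := by
    simpa using (tendsto_const_div_atTop_nhds_zero_nat (k.natAbs : ℝ)).const_sub 1
  refine tendsto_of_tendsto_of_tendsto_of_le_of_le' h0 tendsto_const_nhds ?_ ?_
  · filter_upwards [eventually_gt_atTop 0] with L hL
    have hL' : (0 : ℝ) < L := Nat.cast_pos.2 hL
    rw [one_sub_div hL'.ne']
    refine div_le_div_of_nonneg_right ?_ hL'.le
    exact_mod_cast (card_filter_translate L k).1
  · refine Eventually.of_forall fun L => ?_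
    exact div_le_one_of_le₀ (by exact_mod_cast (card_filter_translate L k).2) (Nat.cast_nonneg _)

theorem tendsto_overlap (c : ℤ × ℤ) : Tendsto (fun L => overlap L c) atTop (𝓝 1) := by
  simp only [overlap_eq]
  simpa using (tendsto_card_filter_translate c.1).mul (tendsto_card_filter_translate c.2)

theorem overlap_nonneg (L : ℕ) (c : ℤ × ℤ) : 0 ≤ overlap L c := by
  unfold overlap
  positivity

theorem overlap_le_one (L : ℕ) (c : ℤ × ℤ) : overlap L c ≤ 1 := by
  rw [overlap_eq]
  refine mul_le_one₀ ?_ (by positivity) ?_ <;>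
  exact div_le_one_of_le₀ (by exact_mod_cast (card_filter_translate L _).2) (Nat.cast_nonneg _)

theorem sum_sum_latticeBox_sub {φ : ℤ × ℤ → ℂ} (hφ : Summable φ) {L : ℕ} (hL : 0 < L) :
    ∑ b ∈ latticeBox L, ∑ a ∈ latticeBox L, φ (a - b) =
      ((L ^ 2 : ℝ) : ℂ) * ∑' c, (overlap L c : ℂ) * φ c := by
  have h1 : ∀ b : ℤ × ℤ, ∑ a ∈ latticeBox L, φ (a - b) =
      ∑' c, if c + b ∈ latticeBox L then φ c else 0 := fun b => by
    rw [← (Equiv.subRight b).tsum_eq fun c => if c + b ∈ latticeBox L then φ c else 0]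
    simp only [Equiv.subRight_apply, sub_add_cancel]
    rw [tsum_eq_sum (s := latticeBox L) fun a ha => if_neg ha]
    exact (Finset.sum_congr rfl fun a ha => if_pos ha).symm
  have h2 : ∀ b ∈ latticeBox L, Summable fun c => if c + b ∈ latticeBox L then φ c else 0 :=
    fun b _ => Summable.of_norm_bounded hφ.norm fun c => by
      split_ifs
      · exact le_rfl
      · rw [norm_zero]
        exact norm_nonneg _
  have hL' : (L : ℂ) ≠ 0 := Nat.cast_ne_zero.2 hL.ne'
  simp only [h1]
  rw [← Summable.tsum_finsetSum h2, ← tsum_mul_left]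
  refine tsum_congr fun c => ?_
  rw [← Finset.sum_filter, Finset.sum_const, nsmul_eq_mul, overlap]
  push_cast
  field_simp

/-- A summable function of positive type on `ℤ²` has a nonnegative sum, because `ℤ²` is
amenable. -/
theorem tsum_nonneg_of_positive_type {φ : ℤ × ℤ → ℂ} (hφ : Summable φ)
    (h : ∀ F : Finset (ℤ × ℤ), 0 ≤ ∑ b ∈ F, ∑ a ∈ F, φ (a - b)) : 0 ≤ ∑' a, φ a := by
  have ht : Tendsto (fun L => ∑' c, (overlap L c : ℂ) * φ c) atTop (𝓝 (∑' c, φ c)) := by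
    refine tendsto_tsum_of_dominated_convergence hφ.norm (fun c => ?_)
      (Eventually.of_forall fun L c => ?_)
    · have := ((Complex.continuous_ofReal.tendsto 1).comp (tendsto_overlap c)).mul_const (φ c)
      simpa using this
    · rw [norm_mul, Complex.norm_of_nonneg (overlap_nonneg L c)]
      exact mul_le_of_le_one_left (norm_nonneg _) (overlap_le_one L c)
  refine ge_of_tendsto ht ?_
  filter_upwards [eventually_gt_atTop 0] with L hL
  have h1 := h (latticeBox L)
  rw [sum_sum_latticeBox_sub hφ hL] at h1
  have hL' : ((L ^ 2 : ℝ) : ℂ) ≠ 0 := by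
    rw [Complex.ofReal_ne_zero]
    positivity
  have h2 : (0 : ℂ) ≤ (((L ^ 2 : ℝ)⁻¹ : ℝ) : ℂ) := Complex.zero_le_real.2 (by positivity)
  have h3 := mul_nonneg h2 h1
  rwa [Complex.ofReal_inv, inv_mul_cancel_left₀ hL'] at h3

end Averaging

section

variable {p : ℤ} {q d : ℕ} {θ : ℝ}

/-- The lattice representation is unitary and projective: inner products of two vectors of
the orbits are values of `moduleInner` up to the cocycle. -/
theorem integral_inner_latticeRep_latticeRep (hq : 0 < q) (hqd : q ∣ d) (ξ ω : 𝓢(ℝ, Cd d))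
    (a b : ℤ × ℤ) :
    ∫ s : ℝ, inner ℂ (latticeRep p q d θ b ω s) (latticeRep p q d θ a ξ s) =
      cocycle θ (-b) a * moduleInner p q d θ ξ ω (a - b) := by
  rw [moduleInner, ← integral_const_mul,
    ← integral_sub_right_eq_self _ ((θ - p / q) * (b.2 : ℝ))]
  congr 1
  funext s
  have hw : ∀ w z : Cd d, inner ℂ (finiteWeyl p q d b w) (finiteWeyl p q d a z) =
      Complex.exp (((2 * Real.pi * ((-b.2 * (a.1 - b.1) : ℤ) * (p / q)) : ℝ) : ℂ) * Complex.I) *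
        inner ℂ w (finiteWeyl p q d (a - b) z) := fun w z => by
    have e : finiteWeyl p q d a z =
        finiteWeyl p q d b (((finiteWeyl p q d b)⁻¹ * finiteWeyl p q d a) z) :=
      (LinearIsometryEquiv.apply_symm_apply (finiteWeyl p q d b) _).symm
    rw [e, LinearIsometryEquiv.inner_map_map, finiteWeyl_inv_mul p hq hqd]
    change inner ℂ w (scalarPhase d _ (finiteWeyl p q d (a - b) z)) = _
    rw [scalarPhase_apply, inner_smul_right]
  rw [latticeRep_apply, latticeRep_apply, latticeRep_apply, inner_smul_left, inner_smul_right,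
    inner_smul_right, hw, sub_add_cancel, ← Complex.exp_conj, cocycle_eq_exp]
  have hs : s - (θ - p / q) * b.2 + (θ - p / q) * a.2 = s + (θ - p / q) * ((a - b).2 : ℤ) := by
    rw [Prod.snd_sub]
    push_cast
    ring
  rw [hs]
  simp only [← mul_assoc, ← Complex.exp_add]
  congr 2
  simp only [map_mul, Complex.conj_I, Complex.conj_ofReal, Prod.fst_sub, Prod.snd_sub,
    Prod.fst_neg, Prod.snd_neg]
  push_cast
  ring

section Positivity

open scoped ComplexOrder

variable {H : Type} [NormedAddCommGroup H] [InnerProductSpace ℂ H]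

/-- Schur's product theorem for a Gram matrix in `ℂ^d` and one in a Hilbert space. -/
theorem sum_sum_inner_mul_inner_nonneg {α : Type*} (F : Finset α) (x : α → Cd d) (h : α → H) :
    0 ≤ ∑ b ∈ F, ∑ a ∈ F, inner ℂ (x b) (x a) * inner ℂ (h a) (h b) := by
  have e : ∑ b ∈ F, ∑ a ∈ F, inner ℂ (x b) (x a) * inner ℂ (h a) (h b) =
      ∑ j : Fin d, inner ℂ (∑ a ∈ F, starRingEnd ℂ (x a j) • h a)
        (∑ b ∈ F, starRingEnd ℂ (x b j) • h b) := by
    simp only [PiLp.inner_apply, RCLike.inner_apply, Finset.sum_mul]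
    rw [Finset.sum_congr rfl fun b _ => Finset.sum_comm, Finset.sum_comm]
    refine Finset.sum_congr rfl fun j _ => ?_
    simp only [sum_inner, inner_sum]
    refine Finset.sum_congr rfl fun a _ => Finset.sum_congr rfl fun b _ => ?_
    rw [inner_smul_left, inner_smul_right, Complex.conj_conj]
    ring
  rw [e]
  refine Finset.sum_nonneg fun j _ => ?_
  rw [inner_self_eq_norm_sq_to_K]
  have hn := Complex.zero_le_real.2 (sq_nonneg ‖∑ a ∈ F, starRingEnd ℂ (x a j) • h a‖)
  rwa [Complex.ofReal_pow] at hn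

variable [CompleteSpace H]

/-- The inner product `⟨ξ, ξ⟩` acts, in every representation composed with `a ↦ -a`, as a positive
operator. The sign is forced by the conventions: `ϖ` and `U` have the same cocycle, so that it is
`⟨ϖ^a ξ, ξ⟩ ⟨U^{-a} h, h⟩` which is of positive type on the group `ℤ²`. -/
theorem isPositive_tsum_moduleInner (hq : 0 < q) (hqd : q ∣ d) (hθ : θ ≠ p / q)
    {U : ℤ × ℤ → H →L[ℂ] H} (hU : IsProjRep θ U) (ξ : 𝓢(ℝ, Cd d)) :
    0 ≤ ∑' a, moduleInner p q d θ ξ ξ a • U (-a) := by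
  have hs := hU.comp_neg.summable_smul (summable_moduleInner hθ ξ ξ)
  rw [ContinuousLinearMap.nonneg_iff_isPositive, ContinuousLinearMap.isPositive_iff_complex]
  intro h
  set φ : ℤ × ℤ → ℂ := fun a => moduleInner p q d θ ξ ξ a * inner ℂ h (U (-a) h) with hφ
  have hsum : HasSum φ (inner ℂ h ((∑' a, moduleInner p q d θ ξ ξ a • U (-a)) h)) := by
    have h1 := (hs.hasSum.mapL (ContinuousLinearMap.apply ℂ H h)).mapL (innerSL ℂ h)
    simpa [inner_smul_right] using h1
  have hinner : ∀ a b, cocycle θ (-a) b * inner ℂ h (U (-(a - b)) h) = inner ℂ (U a h) (U b h) :=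
    fun a b => by
      have e := congrArg (fun T : H →L[ℂ] H => T h) (hU.2 (-a) b)
      have e' : U (-a) (U b h) = cocycle θ (-a) b • U (-(a - b)) h := by
        rw [neg_sub, sub_eq_neg_add]
        exact e
      rw [← inner_smul_right, ← e', ← hU.adjoint_eq, ContinuousLinearMap.star_eq_adjoint,
        ContinuousLinearMap.adjoint_inner_right]
  have hc : ∀ a b, cocycle θ (-b) a * cocycle θ (-a) b = 1 := fun a b => by
    rw [cocycle, cocycle, ← Complex.exp_add, ← Complex.exp_zero]
    congr 1
    simp only [Prod.fst_neg, Prod.snd_neg]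
    push_cast
    ring
  have hpos : 0 ≤ ∑' a, φ a := by
    refine tsum_nonneg_of_positive_type hsum.summable fun F => ?_
    have hi : ∀ a b : ℤ × ℤ, Integrable fun s : ℝ =>
        inner ℂ (latticeRep p q d θ b ξ s) (latticeRep p q d θ a ξ s) :=
      fun a b => integrable_inner_latticeRep ξ (latticeRep p q d θ b ξ) a
    have e : ∀ b a : ℤ × ℤ, φ (a - b) =
        ∫ s : ℝ, inner ℂ (latticeRep p q d θ b ξ s) (latticeRep p q d θ a ξ s) *
          inner ℂ (U a h) (U b h) := fun b a => by
      rw [integral_mul_const, integral_inner_latticeRep_latticeRep hq hqd, ← hinner]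
      linear_combination (-φ (a - b)) * hc a b
    simp only [e]
    rw [Finset.sum_congr rfl fun b _ =>
        (integral_finsetSum F fun a _ => (hi a b).mul_const _).symm,
      ← integral_finsetSum F fun b _ => integrable_finsetSum F fun a _ => (hi a b).mul_const _]
    exact integral_nonneg fun s => sum_sum_inner_mul_inner_nonneg F _ _
  rw [hsum.tsum_eq] at hpos
  have hpos' : 0 ≤ inner ℂ ((∑' a, moduleInner p q d θ ξ ξ a • U (-a)) h) h := by
    rw [← inner_conj_symm]
    exact star_nonneg_iff.2 hpos
  have h3 := Complex.le_def.1 hpos'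
  refine ⟨?_, h3.1⟩
  exact Complex.ext rfl h3.2

end Positivity

/-! ### The norm of the Heisenberg module -/

/-- The real-valued version of `moduleNorm`. -/
noncomputable def moduleNormReal (p : ℤ) (q d : ℕ) (θ : ℝ) (ξ : 𝓢(ℝ, Cd d)) : ℝ :=
  √(torusNormReal θ (moduleInner p q d θ ξ ξ))

theorem moduleNormReal_nonneg (ξ : 𝓢(ℝ, Cd d)) : 0 ≤ moduleNormReal p q d θ ξ :=
  Real.sqrt_nonneg _

theorem moduleNorm_eq (hθ : θ ≠ p / q) (ξ : 𝓢(ℝ, Cd d)) :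
    moduleNorm p q d θ ξ = ENNReal.ofReal (moduleNormReal p q d θ ξ) := by
  rw [moduleNorm, moduleNormReal, Real.sqrt_eq_rpow,
    ← ENNReal.ofReal_rpow_of_nonneg (torusNormReal_nonneg _ _) (by norm_num), torusNormReal,
    ENNReal.ofReal_toReal (torusNorm_ne_top (summable_moduleInner hθ ξ ξ))]

/-- A form of the parallelogram law, in which the last term on the left-hand side is positive. -/
theorem moduleInner_parallelogram {r : ℝ} (hr : r ≠ 0) (ξ η : 𝓢(ℝ, Cd d)) (a : ℤ × ℤ) :
    moduleInner p q d θ (ξ + η) (ξ + η) a +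
      moduleInner p q d θ ((r : ℂ) • ξ + (-(r : ℂ)⁻¹) • η) ((r : ℂ) • ξ + (-(r : ℂ)⁻¹) • η) a =
    ((1 + r ^ 2 : ℝ) : ℂ) * moduleInner p q d θ ξ ξ a +
      ((1 + (r ^ 2)⁻¹ : ℝ) : ℂ) * moduleInner p q d θ η η a := by
  have hr' : (r : ℂ) ≠ 0 := Complex.ofReal_ne_zero.2 hr
  simp only [moduleInner_add_left, moduleInner_add_right, moduleInner_smul_left,
    moduleInner_smul_right, map_neg, map_inv₀, Complex.conj_ofReal]
  push_cast
  field_simp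
  ring

/-- A weighted parallelogram inequality: by positivity, the operator of `ξ + η` is at most the
combination of those of `ξ` and `η` in each representation. -/
theorem torusNormReal_moduleInner_add_le (hq : 0 < q) (hqd : q ∣ d) (hθ : θ ≠ p / q)
    (ξ η : 𝓢(ℝ, Cd d)) {r : ℝ} (hr : 0 < r) :
    torusNormReal θ (moduleInner p q d θ (ξ + η) (ξ + η)) ≤
      (1 + r ^ 2) * torusNormReal θ (moduleInner p q d θ ξ ξ) +
        (1 + (r ^ 2)⁻¹) * torusNormReal θ (moduleInner p q d θ η η) := by
  refine torusNormReal_le (add_nonneg (mul_nonneg (by positivity) (torusNormReal_nonneg _ _))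
    (mul_nonneg (by positivity) (torusNormReal_nonneg _ _))) fun H _ _ _ U hU => ?_
  have hV := hU.comp_neg
  set ζ := (r : ℂ) • ξ + (-(r : ℂ)⁻¹) • η with hζ
  have s1 := hU.summable_smul (summable_moduleInner hθ (ξ + η) (ξ + η))
  have s2 := hU.summable_smul (summable_moduleInner hθ ζ ζ)
  have s3 := hU.summable_smul (summable_moduleInner hθ ξ ξ)
  have s4 := hU.summable_smul (summable_moduleInner hθ η η)
  have p1 := isPositive_tsum_moduleInner hq hqd hθ hV (ξ + η)
  have p2 := isPositive_tsum_moduleInner hq hqd hθ hV ζ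
  simp only [neg_neg] at p1 p2
  have e : ∑' a, moduleInner p q d θ (ξ + η) (ξ + η) a • U a +
      ∑' a, moduleInner p q d θ ζ ζ a • U a =
      ((1 + r ^ 2 : ℝ) : ℂ) • ∑' a, moduleInner p q d θ ξ ξ a • U a +
      ((1 + (r ^ 2)⁻¹ : ℝ) : ℂ) • ∑' a, moduleInner p q d θ η η a • U a := by
    rw [← s1.tsum_add s2, ← s3.tsum_const_smul, ← s4.tsum_const_smul,
      ← (s3.const_smul _).tsum_add (s4.const_smul _)]
    refine tsum_congr fun a => ?_
    rw [← add_smul, moduleInner_parallelogram hr.ne', add_smul, smul_smul, smul_smul]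
  have hle : ∑' a, moduleInner p q d θ (ξ + η) (ξ + η) a • U a ≤
      ((1 + r ^ 2 : ℝ) : ℂ) • ∑' a, moduleInner p q d θ ξ ξ a • U a +
      ((1 + (r ^ 2)⁻¹ : ℝ) : ℂ) • ∑' a, moduleInner p q d θ η η a • U a := by
    rw [← e]
    exact le_add_of_nonneg_right p2
  refine (CStarAlgebra.norm_le_norm_of_nonneg_of_le p1 hle).trans ((norm_add_le _ _).trans ?_)
  rw [norm_smul, norm_smul, Complex.norm_of_nonneg (by positivity),
    Complex.norm_of_nonneg (by positivity)]
  exact add_le_add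
    (mul_le_mul_of_nonneg_left (hU.norm_le_torusNormReal (summable_moduleInner hθ ξ ξ))
      (by positivity))
    (mul_le_mul_of_nonneg_left (hU.norm_le_torusNormReal (summable_moduleInner hθ η η))
      (by positivity))

/-- Optimizing the weight `r` in the weighted parallelogram inequality gives the triangle
inequality. -/
theorem sqrt_le_add_of_forall_le {M x y : ℝ} (hx : 0 ≤ x) (hy : 0 ≤ y)
    (h : ∀ r : ℝ, 0 < r → M ≤ (1 + r ^ 2) * x ^ 2 + (1 + (r ^ 2)⁻¹) * y ^ 2) : √M ≤ x + y := by
  refine le_of_forall_pos_le_add fun ε hε => ?_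
  set x' := x + ε / 2 with hx'
  set y' := y + ε / 2 with hy'
  have px : 0 < x' := by positivity
  have py : 0 < y' := by positivity
  -- Up to the `ε / 2` that keeps it positive and finite, `r = √(y / x)` minimizes the bound.
  have h0 := h (√(y' / x')) (Real.sqrt_pos.2 (div_pos py px))
  rw [Real.sq_sqrt (div_pos py px).le, inv_div] at h0
  rw [Real.sqrt_le_left (by positivity)]
  refine h0.trans ?_
  have h1 : (1 + y' / x') * x ^ 2 ≤ (1 + y' / x') * x' ^ 2 := by gcongr; linarith
  have h2 : (1 + x' / y') * y ^ 2 ≤ (1 + x' / y') * y' ^ 2 := by gcongr; linarith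
  have h3 : (1 + y' / x') * x' ^ 2 + (1 + x' / y') * y' ^ 2 = (x' + y') ^ 2 := by
    field_simp
    ring
  have h4 : x + y + ε = x' + y' := by rw [hx', hy']; ring
  rw [h4]
  linarith

theorem moduleNormReal_sq (ξ : 𝓢(ℝ, Cd d)) :
    moduleNormReal p q d θ ξ ^ 2 = torusNormReal θ (moduleInner p q d θ ξ ξ) :=
  Real.sq_sqrt (torusNormReal_nonneg _ _)

theorem moduleNormReal_add_le (hq : 0 < q) (hqd : q ∣ d) (hθ : θ ≠ p / q) (ξ η : 𝓢(ℝ, Cd d)) :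
    moduleNormReal p q d θ (ξ + η) ≤ moduleNormReal p q d θ ξ + moduleNormReal p q d θ η := by
  refine sqrt_le_add_of_forall_le (moduleNormReal_nonneg ξ) (moduleNormReal_nonneg η) fun r hr => ?_
  rw [moduleNormReal_sq, moduleNormReal_sq]
  exact torusNormReal_moduleInner_add_le hq hqd hθ ξ η hr

theorem moduleInner_smul_self (c : ℂ) (ξ : 𝓢(ℝ, Cd d)) :
    moduleInner p q d θ (c • ξ) (c • ξ) =
      fun a => ((‖c‖ ^ 2 : ℝ) : ℂ) * moduleInner p q d θ ξ ξ a := by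
  funext a
  rw [moduleInner_smul_left, moduleInner_smul_right, ← mul_assoc, Complex.mul_conj,
    Complex.normSq_eq_norm_sq]

theorem moduleNormReal_smul_le (hθ : θ ≠ p / q) (c : ℂ) (ξ : 𝓢(ℝ, Cd d)) :
    moduleNormReal p q d θ (c • ξ) ≤ ‖c‖ * moduleNormReal p q d θ ξ := by
  rw [moduleNormReal, moduleInner_smul_self, Real.sqrt_le_left
    (mul_nonneg (norm_nonneg _) (moduleNormReal_nonneg _)), mul_pow, moduleNormReal,
    Real.sq_sqrt (torusNormReal_nonneg _ _)]
  refine (torusNormReal_const_mul θ (summable_moduleInner hθ ξ ξ) _).trans_eq ?_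
  rw [Complex.norm_of_nonneg (by positivity)]

theorem moduleNormReal_smul (hθ : θ ≠ p / q) (c : ℂ) (ξ : 𝓢(ℝ, Cd d)) :
    moduleNormReal p q d θ (c • ξ) = ‖c‖ * moduleNormReal p q d θ ξ := by
  rcases eq_or_ne c 0 with rfl | hc
  · refine le_antisymm (moduleNormReal_smul_le hθ 0 ξ) ?_
    rw [norm_zero, zero_mul]
    exact moduleNormReal_nonneg _
  refine le_antisymm (moduleNormReal_smul_le hθ c ξ) ?_
  have h := moduleNormReal_smul_le hθ c⁻¹ (c • ξ)
  rw [smul_smul, inv_mul_cancel₀ hc, one_smul, norm_inv] at h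
  rwa [← le_inv_mul_iff₀ (norm_pos_iff.2 hc)]

end

section

variable {p : ℤ} {q d : ℕ} {θ : ℝ}

/-! ### Joint continuity of the norms of the Heisenberg modules -/

/-- Each value of the inner product is continuous along a family of Schwartz functions with a
uniform decay. Only the values that enter the integrand are required to converge, so that the same
statement covers a varying parameter and difference quotients at a fixed parameter. -/
theorem tendsto_moduleInner {ι : Type*} {l : Filter ι} [l.IsCountablyGenerated] {τ : ι → ℝ}
    (hτ : Tendsto τ l (𝓝 θ)) {η : ι → 𝓢(ℝ, Cd d)} {η₀ : 𝓢(ℝ, Cd d)} {B : ℝ}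
    (hB : ∀ᶠ i in l, HasDecay₂ B (η i))
    (hη : ∀ (s : ℝ) (m : ℤ), Tendsto (fun i => η i (s + (τ i - p / q) * m)) l
      (𝓝 (η₀ (s + (θ - p / q) * m)))) (a : ℤ × ℤ) :
    Tendsto (fun i => moduleInner p q d (τ i) (η i) (η i) a) l
      (𝓝 (moduleInner p q d θ η₀ η₀ a)) := by
  refine tendsto_integral_filter_of_dominated_convergence
    (fun s => 2 * B * B * 1 * (1 + s ^ 2)⁻¹)
    (Eventually.of_forall fun i => (continuous_inner_latticeRep _ _ a).aestronglyMeasurable)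
    (hB.mono fun i hi => Eventually.of_forall fun s => ?_)
    (integrable_inv_one_add_sq.const_mul _) (Eventually.of_forall fun s => ?_)
  · refine (norm_inner_latticeRep_le hi.1 hi.1 a s).trans ?_
    have := hi.1.nonneg
    gcongr
    exact inv_le_one_of_one_le₀ (le_add_of_nonneg_right (sq_nonneg _))
  · simp only [latticeRep_apply]
    have h1 : Tendsto (fun i => η i s) l (𝓝 (η₀ s)) := by simpa using hη s 0
    have h2 : Tendsto (fun i => Complex.exp
        (((Real.pi * (τ i * a.1 * a.2 + 2 * s * a.1) : ℝ) : ℂ) * Complex.I)) l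
        (𝓝 (Complex.exp (((Real.pi * (θ * a.1 * a.2 + 2 * s * a.1) : ℝ) : ℂ) * Complex.I))) := by
      have hc : Continuous fun t : ℝ => Complex.exp
          (((Real.pi * (t * a.1 * a.2 + 2 * s * a.1) : ℝ) : ℂ) * Complex.I) := by fun_prop
      exact (hc.tendsto θ).comp hτ
    have h3 := ((finiteWeyl p q d a).continuous.tendsto _).comp (hη s a.2)
    exact h1.inner (h2.smul h3)

theorem tendsto_moduleNormReal {ι : Type*} {l : Filter ι} [l.IsCountablyGenerated] {τ : ι → ℝ}
    (hτ : Tendsto τ l (𝓝 θ)) (hθ : θ ≠ p / q) {η : ι → 𝓢(ℝ, Cd d)} {η₀ : 𝓢(ℝ, Cd d)} {B : ℝ}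
    (hB : ∀ᶠ i in l, HasDecay₂ B (η i)) (hB₀ : HasDecay₂ B η₀)
    (hη : ∀ (s : ℝ) (m : ℤ), Tendsto (fun i => η i (s + (τ i - p / q) * m)) l
      (𝓝 (η₀ (s + (θ - p / q) * m)))) :
    Tendsto (fun i => moduleNormReal p q d (τ i) (η i)) l (𝓝 (moduleNormReal p q d θ η₀)) := by
  have hpos : 0 < |θ - p / q| := abs_pos.2 (sub_ne_zero.2 hθ)
  set δ := |θ - p / q| / 2 with hδ
  have hδ0 : 0 < δ := half_pos hpos
  have hτδ : ∀ᶠ i in l, δ ≤ |τ i - p / q| :=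
    (((hτ.sub_const _).abs).eventually (lt_mem_nhds (half_lt_self hpos))).mono fun _ h => h.le
  refine (tendsto_torusNormReal hτ (hτδ.mono fun i hi => ?_) (summable_moduleInner hθ η₀ η₀)
    ?_).sqrt
  · refine summable_moduleInner (fun h => ?_) _ _
    rw [h, sub_self, abs_zero] at hi
    exact hδ0.not_ge hi
  · set C := 10 * Real.pi * B * B * (1 + (δ ^ 2)⁻¹)
    have hlim : Tendsto (fun i => ∑' a, ‖moduleInner p q d (τ i) (η i) (η i) a -
        moduleInner p q d θ η₀ η₀ a‖) l (𝓝 (∑' _ : ℤ × ℤ, (0 : ℝ))) := by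
      refine tendsto_tsum_of_dominated_convergence
        ((summable_latticeMajorant.mul_left C).add (summable_latticeMajorant.mul_left C))
        (fun a => ?_) ((hB.and hτδ).mono fun i hi a => ?_)
      · have h := (tendsto_moduleInner hτ hB hη a).sub_const (moduleInner p q d θ η₀ η₀ a)
        rw [sub_self] at h
        simpa using h.norm
      · rw [norm_norm]
        exact (norm_sub_le _ _).trans (add_le_add
          (norm_moduleInner_le_latticeMajorant hi.1 hi.1 hδ0 hi.2 a)
          (norm_moduleInner_le_latticeMajorant hB₀ hB₀ hδ0 (half_lt_self hpos).le a))
    rwa [tsum_zero] at hlim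

theorem continuous_moduleNormReal {T : Type*} [TopologicalSpace T] [FirstCountableTopology T]
    {τ : T → ℝ} (hτ : Continuous τ) (hne : ∀ t, τ t ≠ p / q) {η : T → 𝓢(ℝ, Cd d)} {K : T → ℝ}
    (hK : Continuous K) (hηK : ∀ t, HasDecay₂ (K t) (η t))
    (hη : Continuous fun x : T × ℝ => η x.1 x.2) :
    Continuous fun t => moduleNormReal p q d (τ t) (η t) := by
  refine continuous_iff_continuousAt.2 fun t₀ => ?_
  have hev : ∀ᶠ t in 𝓝 t₀, K t ≤ K t₀ + 1 :=
    (hK.continuousAt.eventually (gt_mem_nhds (lt_add_one _))).mono fun _ h => h.le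
  refine tendsto_moduleNormReal (hτ.tendsto t₀) (hne t₀) (B := K t₀ + 1)
    (hev.mono fun t ht => (hηK t).mono ht) ((hηK t₀).mono (le_add_of_nonneg_right zero_le_one))
    fun s m => ?_
  have hc : Continuous fun t => η t (s + (τ t - p / q) * m) :=
    hη.comp (continuous_id.prodMk (continuous_const.add ((hτ.sub continuous_const).mul
      continuous_const)))
  exact hc.tendsto t₀

/-! ### The Schrödinger representation by isometries -/

theorem schrodinger_apply (ð x y : ℝ) (ξ : 𝓢(ℝ, Cd d)) (s : ℝ) :
    schrodinger ð x y ξ s =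
      Complex.exp (((Real.pi * (ð * x * y + 2 * s * x) : ℝ) : ℂ) * Complex.I) •
        ξ (s + ð * y) := by
  rw [schrodinger, heisRep_apply]
  congr 2
  push_cast
  ring

theorem schrodinger_zero (ð : ℝ) (ξ : 𝓢(ℝ, Cd d)) : schrodinger ð 0 0 ξ = ξ := by
  ext1 s
  rw [schrodinger_apply]
  simp

theorem schrodinger_sub (ð x y : ℝ) (ξ η : 𝓢(ℝ, Cd d)) :
    schrodinger ð x y (ξ - η) = schrodinger ð x y ξ - schrodinger ð x y η := by
  ext1 s
  simp only [schrodinger_apply, sub_apply, smul_sub]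

theorem schrodinger_schrodinger_mul (ð x y r : ℝ) (ξ : 𝓢(ℝ, Cd d)) :
    schrodinger ð x y (schrodinger ð (r * x) (r * y) ξ) =
      schrodinger ð ((r + 1) * x) ((r + 1) * y) ξ := by
  ext1 s
  rw [schrodinger_apply, schrodinger_apply, schrodinger_apply, smul_smul, ← Complex.exp_add,
    add_assoc]
  congr 2
  · push_cast
    ring
  · congr 1
    ring

/-- The character of `ℤ²` that measures the commutation of `schrodinger ð x y` with the lattice. -/
noncomputable def commutationCharacter (ð x y : ℝ) (a : ℤ × ℤ) : ℂ :=
  Complex.exp (((2 * Real.pi * ð * (a.2 * x - a.1 * y) : ℝ) : ℂ) * Complex.I)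

/-- `schrodinger` commutes with `latticeRep` up to a phase, so that it acts on the inner product
through the dual action of a character. -/
theorem moduleInner_schrodinger (x y : ℝ) (ξ : 𝓢(ℝ, Cd d)) (a : ℤ × ℤ) :
    moduleInner p q d θ (schrodinger (θ - p / q) x y ξ) (schrodinger (θ - p / q) x y ξ) a =
      commutationCharacter (θ - p / q) x y a * moduleInner p q d θ ξ ξ a := by
  rw [moduleInner, moduleInner, ← integral_const_mul,
    ← integral_sub_right_eq_self _ ((θ - p / q) * y)]
  congr 1
  funext s
  rw [latticeRep_apply, latticeRep_apply, schrodinger_apply, schrodinger_apply, map_smul,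
    inner_smul_left, inner_smul_right, inner_smul_right, inner_smul_right, sub_add_cancel,
    ← Complex.exp_conj, commutationCharacter]
  have hs : s - (θ - p / q) * y + (θ - p / q) * a.2 + (θ - p / q) * y =
      s + (θ - p / q) * a.2 := by ring
  rw [hs]
  simp only [← mul_assoc, ← Complex.exp_add]
  congr 2
  simp only [map_mul, Complex.conj_I, Complex.conj_ofReal]
  push_cast
  ring

theorem moduleNormReal_schrodinger_le (hθ : θ ≠ p / q) (x y : ℝ) (ξ : 𝓢(ℝ, Cd d)) :
    moduleNormReal p q d θ (schrodinger (θ - p / q) x y ξ) ≤ moduleNormReal p q d θ ξ := by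
  refine Real.sqrt_le_sqrt ?_
  rw [funext (moduleInner_schrodinger x y ξ)]
  refine torusNormReal_character_mul_le θ (summable_moduleInner hθ ξ ξ)
    (fun a => Complex.norm_exp_ofReal_mul_I _) fun a b => ?_
  rw [commutationCharacter, commutationCharacter, commutationCharacter, ← Complex.exp_add,
    Prod.fst_add, Prod.snd_add]
  congr 1
  push_cast
  ring

/-- Telescoping along a one-parameter group of isometries. -/
theorem moduleNormReal_schrodinger_sub_le_nat_mul (hq : 0 < q) (hqd : q ∣ d) (hθ : θ ≠ p / q)
    (x y : ℝ) (ξ : 𝓢(ℝ, Cd d)) (n : ℕ) :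
    moduleNormReal p q d θ (schrodinger (θ - p / q) (n * x) (n * y) ξ - ξ) ≤
      n * moduleNormReal p q d θ (schrodinger (θ - p / q) x y ξ - ξ) := by
  induction n with
  | zero =>
    rw [Nat.cast_zero, zero_mul, zero_mul, zero_mul, schrodinger_zero, sub_self,
      ← zero_smul ℂ ξ, moduleNormReal_smul hθ, norm_zero, zero_mul]
  | succ n ih =>
    have e : schrodinger (θ - p / q) ((n + 1 : ℕ) * x) ((n + 1 : ℕ) * y) ξ - ξ =
        schrodinger (θ - p / q) x y (schrodinger (θ - p / q) (n * x) (n * y) ξ - ξ) +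
          (schrodinger (θ - p / q) x y ξ - ξ) := by
      rw [schrodinger_sub, schrodinger_schrodinger_mul, Nat.cast_succ]
      abel
    rw [e, Nat.cast_succ, add_mul, one_mul]
    exact (moduleNormReal_add_le hq hqd hθ _ _).trans
      (add_le_add ((moduleNormReal_schrodinger_le hθ x y _).trans ih) le_rfl)

/-! ### The derivatives of the Schrödinger representation -/

/-- Multiplication of a Schwartz function by the variable. -/
noncomputable def mulX (ξ : 𝓢(ℝ, Cd d)) : 𝓢(ℝ, Cd d) :=
  SchwartzMap.smulLeftCLM (Cd d) (fun s : ℝ => (s : ℂ)) ξ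

theorem mulX_apply (ξ : 𝓢(ℝ, Cd d)) (s : ℝ) : mulX ξ s = (s : ℂ) • ξ s :=
  SchwartzMap.smulLeftCLM_apply_apply Complex.ofRealCLM.hasTemperateGrowth ξ s

/-- The derivative at `0`, in the direction `z`, of the Schrödinger representation for the Planck
constant `ð`. -/
noncomputable def nabla (ð : ℝ) (z : ℝ × ℝ) (ξ : 𝓢(ℝ, Cd d)) : 𝓢(ℝ, Cd d) :=
  (2 * Real.pi * z.1 * Complex.I : ℂ) • mulX ξ + ((ð * z.2 : ℝ) : ℂ) • derivS ξ

theorem nabla_apply (ð : ℝ) (z : ℝ × ℝ) (ξ : 𝓢(ℝ, Cd d)) (s : ℝ) :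
    nabla ð z ξ s = (2 * Real.pi * z.1 * s * Complex.I : ℂ) • ξ s +
      ((ð * z.2 : ℝ) : ℂ) • derivS ξ s := by
  rw [nabla, add_apply, smul_apply, smul_apply, mulX_apply, smul_smul]
  congr 2
  ring

theorem nabla_smul (ð c : ℝ) (z : ℝ × ℝ) (ξ : 𝓢(ℝ, Cd d)) :
    nabla ð (c • z) ξ = (c : ℂ) • nabla ð z ξ := by
  rw [nabla, nabla, smul_add, smul_smul, smul_smul, Prod.smul_fst, Prod.smul_snd, smul_eq_mul,
    smul_eq_mul]
  congr 2
  · push_cast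
    ring
  · push_cast
    ring

theorem hasDerivAt_schrodinger_param (ð : ℝ) (z : ℝ × ℝ) (ξ : 𝓢(ℝ, Cd d)) (s t : ℝ) :
    HasDerivAt (fun t : ℝ => schrodinger ð (t * z.1) (t * z.2) ξ s)
      (schrodinger ð (t * z.1) (t * z.2) (nabla ð z ξ) s) t := by
  simp only [schrodinger_apply]
  have h1 : HasDerivAt (fun t : ℝ =>
      Complex.exp (((Real.pi * (ð * (t * z.1) * (t * z.2) + 2 * s * (t * z.1)) : ℝ) : ℂ) *
        Complex.I))
      (Complex.exp (((Real.pi * (ð * (t * z.1) * (t * z.2) + 2 * s * (t * z.1)) : ℝ) : ℂ) *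
        Complex.I) * (2 * Real.pi * z.1 * (s + ð * (t * z.2)) * Complex.I)) t := by
    have hx : HasDerivAt (fun t : ℝ => t * z.1) z.1 t := by
      simpa using (hasDerivAt_id t).mul_const z.1
    have hy : HasDerivAt (fun t : ℝ => t * z.2) z.2 t := by
      simpa using (hasDerivAt_id t).mul_const z.2
    have h := (((hx.const_mul ð).fun_mul hy).fun_add (hx.const_mul (2 * s))).const_mul Real.pi
    have h' := (h.ofReal_comp.mul_const Complex.I).cexp
    convert h' using 1
    push_cast
    ring
  have h2 : HasDerivAt (fun t : ℝ => ξ (s + ð * (t * z.2)))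
      ((ð * z.2) • derivS ξ (s + ð * (t * z.2))) t := by
    have hy : HasDerivAt (fun t : ℝ => s + ð * (t * z.2)) (ð * z.2) t := by
      simpa using (((hasDerivAt_id t).mul_const z.2).const_mul ð).const_add s
    exact (hasDerivAt_derivS ξ (s + ð * (t * z.2))).scomp t hy
  refine (h1.fun_smul h2).congr_deriv ?_
  rw [nabla_apply, smul_add, smul_smul, add_comm, Complex.coe_smul]
  congr 3
  push_cast
  ring

theorem derivS_schrodinger (ð x y : ℝ) (ξ : 𝓢(ℝ, Cd d)) :
    derivS (schrodinger ð x y ξ) =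
      (2 * Real.pi * x * Complex.I : ℂ) • schrodinger ð x y ξ + schrodinger ð x y (derivS ξ) := by
  ext1 s
  have h1 : HasDerivAt (fun s : ℝ =>
      Complex.exp (((Real.pi * (ð * x * y + 2 * s * x) : ℝ) : ℂ) * Complex.I))
      (Complex.exp (((Real.pi * (ð * x * y + 2 * s * x) : ℝ) : ℂ) * Complex.I) *
        (2 * Real.pi * x * Complex.I)) s := by
    have h : HasDerivAt (fun s : ℝ => Real.pi * (ð * x * y + 2 * s * x))
        (Real.pi * (2 * 1 * x)) s :=
      ((((hasDerivAt_id s).const_mul 2).mul_const x).const_add _).const_mul _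
    have h' := (h.ofReal_comp.mul_const Complex.I).cexp
    convert h' using 1
    push_cast
    ring
  have h3 := h1.fun_smul ((hasDerivAt_derivS ξ (s + ð * y)).comp_add_const s _)
  have h4 : (fun s : ℝ =>
      Complex.exp (((Real.pi * (ð * x * y + 2 * s * x) : ℝ) : ℂ) * Complex.I) • ξ (s + ð * y)) =
      (schrodinger ð x y ξ : ℝ → Cd d) := by
    funext s
    rw [schrodinger_apply]
  rw [h4] at h3
  rw [(hasDerivAt_derivS (schrodinger ð x y ξ) s).unique h3, add_apply, smul_apply,
    schrodinger_apply, schrodinger_apply, smul_smul, add_comm, mul_comm (2 * _ * _ * _)]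

theorem hasDecay_schrodinger {B : ℝ} {ξ : 𝓢(ℝ, Cd d)} (h : HasDecay B ξ) (ð x y : ℝ) :
    HasDecay ((2 * (1 + (ð * y) ^ 2)) ^ 2 * B) (schrodinger ð x y ξ) := fun s => by
  rw [schrodinger_apply, norm_smul, Complex.norm_exp_ofReal_mul_I, one_mul]
  have h1 := one_add_sq_le_mul (ð * y) s
  rw [add_comm (ð * y) s] at h1
  calc (1 + s ^ 2) ^ 2 * ‖ξ (s + ð * y)‖
      ≤ (2 * (1 + (ð * y) ^ 2) * (1 + (s + ð * y) ^ 2)) ^ 2 * ‖ξ (s + ð * y)‖ := by gcongr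
    _ = (2 * (1 + (ð * y) ^ 2)) ^ 2 * ((1 + (s + ð * y) ^ 2) ^ 2 * ‖ξ (s + ð * y)‖) := by ring
    _ ≤ _ := by gcongr; exact h _

/-- The difference quotients of the Schrödinger representation. -/
noncomputable def diffQuot (ð : ℝ) (z : ℝ × ℝ) (t : ℝ) (ξ : 𝓢(ℝ, Cd d)) : 𝓢(ℝ, Cd d) :=
  ((t⁻¹ : ℝ) : ℂ) • (schrodinger ð (t * z.1) (t * z.2) ξ - ξ)

theorem tendsto_diffQuot_apply (ð : ℝ) (z : ℝ × ℝ) (ξ : 𝓢(ℝ, Cd d)) (s : ℝ) :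
    Tendsto (fun t => diffQuot ð z t ξ s) (𝓝[>] 0) (𝓝 (nabla ð z ξ s)) := by
  have h := (hasDerivAt_schrodinger_param ð z ξ s 0).tendsto_slope
  simp only [zero_mul, schrodinger_zero] at h
  refine (h.mono_left (nhdsWithin_mono _ fun t ht => ne_of_gt ht)).congr fun t => ?_
  rw [slope_def_module, diffQuot, smul_apply, sub_apply, sub_zero, zero_mul, zero_mul,
    schrodinger_zero, Complex.coe_smul]

theorem hasDecay_schrodinger_mul {B : ℝ} {ξ : 𝓢(ℝ, Cd d)} (h : HasDecay B ξ) (ð : ℝ) (z : ℝ × ℝ)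
    {t : ℝ} (ht : t ∈ Set.Icc (0 : ℝ) 1) :
    HasDecay ((2 * (1 + (ð * z.2) ^ 2)) ^ 2 * B) (schrodinger ð (t * z.1) (t * z.2) ξ) := by
  refine (hasDecay_schrodinger h ð (t * z.1) (t * z.2)).mono ?_
  have hB := h.nonneg
  have h1 : (ð * (t * z.2)) ^ 2 ≤ (ð * z.2) ^ 2 := by
    rw [show ð * (t * z.2) = t * (ð * z.2) by ring, mul_pow]
    exact mul_le_of_le_one_left (sq_nonneg _) (pow_le_one₀ ht.1 ht.2)
  gcongr

/-- Mean value inequality for the Schrödinger representation, uniformly on the line. -/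
theorem hasDecay_diffQuot {B : ℝ} {ξ : 𝓢(ℝ, Cd d)} {ð : ℝ} {z : ℝ × ℝ}
    (h : HasDecay B (nabla ð z ξ)) {t : ℝ} (ht : t ∈ Set.Ioc (0 : ℝ) 1) :
    HasDecay ((2 * (1 + (ð * z.2) ^ 2)) ^ 2 * B) (diffQuot ð z t ξ) := fun s => by
  have hs : (0 : ℝ) < (1 + s ^ 2) ^ 2 := by positivity
  have hmv := Convex.norm_image_sub_le_of_norm_hasDerivWithin_le (𝕜 := ℝ) (s := Set.Icc (0 : ℝ) 1)
    (f := fun t : ℝ => schrodinger ð (t * z.1) (t * z.2) ξ s)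
    (f' := fun t : ℝ => schrodinger ð (t * z.1) (t * z.2) (nabla ð z ξ) s) (x := 0) (y := t)
    (C := ((2 * (1 + (ð * z.2) ^ 2)) ^ 2 * B) / (1 + s ^ 2) ^ 2)
    (fun τ _ => (hasDerivAt_schrodinger_param ð z ξ s τ).hasDerivWithinAt)
    (fun τ hτ => by
      rw [le_div_iff₀ hs, mul_comm]
      exact hasDecay_schrodinger_mul h ð z hτ s)
    (convex_Icc 0 1) (Set.left_mem_Icc.2 zero_le_one) ⟨ht.1.le, ht.2⟩
  rw [zero_mul, zero_mul, schrodinger_zero, sub_zero, Real.norm_of_nonneg ht.1.le] at hmv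
  rw [diffQuot, smul_apply, sub_apply, norm_smul, Complex.norm_real,
    Real.norm_of_nonneg (inv_nonneg.2 ht.1.le)]
  calc (1 + s ^ 2) ^ 2 * (t⁻¹ * ‖schrodinger ð (t * z.1) (t * z.2) ξ s - ξ s‖)
      ≤ (1 + s ^ 2) ^ 2 *
        (t⁻¹ * (((2 * (1 + (ð * z.2) ^ 2)) ^ 2 * B) / (1 + s ^ 2) ^ 2 * t)) := by
        have := ht.1
        gcongr
    _ = (2 * (1 + (ð * z.2) ^ 2)) ^ 2 * B := by
        have := ht.1.ne'
        field_simp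

/-- The commutator of the derivative with the difference quotients stays bounded as `t` tends to
`0`. -/
theorem derivS_diffQuot (ð : ℝ) (z : ℝ × ℝ) {t : ℝ} (ht : t ≠ 0) (ξ : 𝓢(ℝ, Cd d)) :
    derivS (diffQuot ð z t ξ) = diffQuot ð z t (derivS ξ) +
      (2 * Real.pi * z.1 * Complex.I : ℂ) • schrodinger ð (t * z.1) (t * z.2) ξ := by
  have e := derivS_schrodinger ð (t * z.1) (t * z.2) ξ
  have ht' : (t : ℂ) ≠ 0 := Complex.ofReal_ne_zero.2 ht
  have hc : ((t⁻¹ : ℝ) : ℂ) * (2 * Real.pi * ((t * z.1 : ℝ) : ℂ) * Complex.I) =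
      2 * Real.pi * z.1 * Complex.I := by
    push_cast
    field_simp
  rw [diffQuot, diffQuot, derivS, map_smul, map_sub]
  change _ • (derivS _ - derivS ξ) = _
  rw [e, add_sub_assoc, smul_add, smul_smul, hc, add_comm]

/-- The difference quotients have a decay that is uniform in `t`, which is what dominated
convergence requires of them. -/
theorem exists_hasDecay₂_diffQuot (ð : ℝ) (z : ℝ × ℝ) (ξ : 𝓢(ℝ, Cd d)) :
    ∃ B, ∀ t ∈ Set.Ioc (0 : ℝ) 1, HasDecay₂ B (diffQuot ð z t ξ) := by
  have key : ∀ η : 𝓢(ℝ, Cd d), ∃ B, ∀ t ∈ Set.Ioc (0 : ℝ) 1, HasDecay B (diffQuot ð z t η) ∧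
      HasDecay B (schrodinger ð (t * z.1) (t * z.2) η) := fun η => by
    obtain ⟨A, hA⟩ := exists_hasDecay (nabla ð z η)
    obtain ⟨B, hB⟩ := exists_hasDecay η
    exact ⟨_, fun t ht => ⟨(hasDecay_diffQuot hA ht).mono (le_max_left _ _),
      (hasDecay_schrodinger_mul hB ð z ⟨ht.1.le, ht.2⟩).mono (le_max_right _ _)⟩⟩
  obtain ⟨B0, h0⟩ := key ξ
  obtain ⟨B1, h1⟩ := key (derivS ξ)
  obtain ⟨B2, h2⟩ := key (derivS (derivS ξ))
  set c : ℂ := 2 * Real.pi * z.1 * Complex.I with hc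
  have h0' : 0 ≤ B0 := (h0 1 ⟨one_pos, le_rfl⟩).1.nonneg
  have h1' : 0 ≤ B1 := (h1 1 ⟨one_pos, le_rfl⟩).1.nonneg
  have h2' : 0 ≤ B2 := (h2 1 ⟨one_pos, le_rfl⟩).1.nonneg
  refine ⟨B0 + (B1 + ‖c‖ * B0) + (B2 + ‖c‖ * B1 + ‖c‖ * (‖c‖ * B0 + B1)), fun t ht => ?_⟩
  have p1 : 0 ≤ ‖c‖ * B0 := by positivity
  have p2 : 0 ≤ ‖c‖ * B1 := by positivity
  have p3 : 0 ≤ ‖c‖ * (‖c‖ * B0 + B1) := by positivity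
  refine ⟨(h0 t ht).1.mono (by linarith), ?_, ?_⟩
  · rw [derivS_diffQuot ð z ht.1.ne']
    exact ((h1 t ht).1.add ((h0 t ht).2.smul c)).mono (by linarith)
  · rw [derivS_diffQuot ð z ht.1.ne', derivS, map_add, map_smul]
    change HasDecay _ (derivS (diffQuot ð z t (derivS ξ)) +
      c • derivS (schrodinger ð (t * z.1) (t * z.2) ξ))
    rw [derivS_diffQuot ð z ht.1.ne', derivS_schrodinger]
    have hb : HasDecay (‖c‖ * B0) ((2 * Real.pi * ((t * z.1 : ℝ) : ℂ) * Complex.I : ℂ) •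
        schrodinger ð (t * z.1) (t * z.2) ξ) := by
      refine ((h0 t ht).2.smul _).mono (mul_le_mul_of_nonneg_right ?_ h0')
      rw [show (2 * Real.pi * ((t * z.1 : ℝ) : ℂ) * Complex.I : ℂ) = (t : ℂ) * c by
        rw [hc]; push_cast; ring, norm_mul, Complex.norm_of_nonneg ht.1.le]
      exact mul_le_of_le_one_left (norm_nonneg _) ht.2
    exact (((h2 t ht).1.add ((h1 t ht).2.smul c)).add ((hb.add (h1 t ht).2).smul c)).mono
      (by linarith)

theorem tendsto_moduleNormReal_diffQuot (hθ : θ ≠ p / q) (z : ℝ × ℝ) (ξ : 𝓢(ℝ, Cd d)) :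
    Tendsto (fun t => moduleNormReal p q d θ (diffQuot (θ - p / q) z t ξ)) (𝓝[>] 0)
      (𝓝 (moduleNormReal p q d θ (nabla (θ - p / q) z ξ))) := by
  obtain ⟨A, hA⟩ := exists_hasDecay₂_diffQuot (θ - p / q) z ξ
  obtain ⟨B, hB⟩ := exists_hasDecay₂ (nabla (θ - p / q) z ξ)
  have hev : ∀ᶠ t in 𝓝[>] (0 : ℝ), t ∈ Set.Ioc (0 : ℝ) 1 := Ioc_mem_nhdsGT zero_lt_one
  exact tendsto_moduleNormReal tendsto_const_nhds hθ (B := max A B)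
    (hev.mono fun t ht => (hA t ht).mono (le_max_left _ _)) (hB.mono (le_max_right _ _))
    fun s m => tendsto_diffQuot_apply _ z ξ _

theorem moduleNormReal_diffQuot (hθ : θ ≠ p / q) (z : ℝ × ℝ) (ξ : 𝓢(ℝ, Cd d)) {t : ℝ}
    (ht : 0 < t) : moduleNormReal p q d θ (diffQuot (θ - p / q) z t ξ) =
      t⁻¹ * moduleNormReal p q d θ (schrodinger (θ - p / q) (t * z.1) (t * z.2) ξ - ξ) := by
  rw [diffQuot, moduleNormReal_smul hθ, Complex.norm_real, Real.norm_of_nonneg (inv_nonneg.2 ht.le)]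

/-- Mean value inequality in the Heisenberg module. -/
theorem moduleNormReal_schrodinger_sub_le (hq : 0 < q) (hqd : q ∣ d) (hθ : θ ≠ p / q)
    (z : ℝ × ℝ) (ξ : 𝓢(ℝ, Cd d)) :
    moduleNormReal p q d θ (schrodinger (θ - p / q) z.1 z.2 ξ - ξ) ≤
      moduleNormReal p q d θ (nabla (θ - p / q) z ξ) := by
  have hlim : Tendsto (fun n : ℕ => (((n : ℝ) + 1)⁻¹)) atTop (𝓝[>] 0) := by
    refine tendsto_nhdsWithin_iff.2 ⟨?_, Eventually.of_forall fun n => ?_⟩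
    · simpa only [one_div] using tendsto_one_div_add_atTop_nhds_zero_nat (𝕜 := ℝ)
    · exact Set.mem_Ioi.2 (inv_pos.2 (by positivity))
  refine ge_of_tendsto ((tendsto_moduleNormReal_diffQuot hθ z ξ).comp hlim)
    (Eventually.of_forall fun n => ?_)
  have hn : (0 : ℝ) < (n : ℝ) + 1 := by positivity
  have h := moduleNormReal_schrodinger_sub_le_nat_mul hq hqd hθ (((n : ℝ) + 1)⁻¹ * z.1)
    (((n : ℝ) + 1)⁻¹ * z.2) ξ (n + 1)
  rw [Nat.cast_succ, mul_inv_cancel_left₀ hn.ne', mul_inv_cancel_left₀ hn.ne'] at h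
  rw [Function.comp_apply, moduleNormReal_diffQuot hθ z ξ (inv_pos.2 hn), inv_inv]
  exact h

end

section

variable {p : ℤ} {q d : ℕ} {θ : ℝ}

/-! ### The D-norm as a maximum over directions -/

theorem continuous_seminorm_prod (N : Seminorm ℝ (ℝ × ℝ)) : Continuous N := by
  refine Seminorm.continuous_of_continuousAt_zero ?_
  have hle : ∀ z : ℝ × ℝ, N z ≤ |z.1| * N (1, 0) + |z.2| * N (0, 1) := fun z => by
    have e : z = z.1 • ((1 : ℝ), (0 : ℝ)) + z.2 • ((0 : ℝ), (1 : ℝ)) := by ext <;> simp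
    calc N z = N (z.1 • ((1 : ℝ), (0 : ℝ)) + z.2 • ((0 : ℝ), (1 : ℝ))) := by rw [← e]
      _ ≤ _ := (map_add_le_add N _ _).trans_eq (by
        rw [map_smul_eq_mul, map_smul_eq_mul, Real.norm_eq_abs, Real.norm_eq_abs])
  have hc : Continuous fun z : ℝ × ℝ => |z.1| * N (1, 0) + |z.2| * N (0, 1) := by fun_prop
  have h0 := hc.tendsto 0
  simp only [Prod.fst_zero, Prod.snd_zero, abs_zero, zero_mul, add_zero] at h0
  rw [ContinuousAt, map_zero]
  exact squeeze_zero (fun z => apply_nonneg N z) hle h0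

/-- The normalized size of the derivative of `ξ` in the direction `z`. -/
noncomputable def directionalSize (N : Seminorm ℝ (ℝ × ℝ)) (p : ℤ) (q d : ℕ) (θ : ℝ)
    (ξ : 𝓢(ℝ, Cd d)) (z : ℝ × ℝ) : ℝ :=
  moduleNormReal p q d θ (nabla (θ - p / q) z ξ) / (2 * Real.pi * |θ - p / q| * N z)

/-- The real number which the D-norm is shown to be equal to: all difference quotients are replaced
by derivatives in unit directions. -/
noncomputable def dNormReal (N : Seminorm ℝ (ℝ × ℝ)) (p : ℤ) (q d : ℕ) (θ : ℝ)
    (ξ : 𝓢(ℝ, Cd d)) : ℝ :=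
  max (moduleNormReal p q d θ ξ)
    (sSup ((fun z : Metric.sphere (0 : ℝ × ℝ) 1 => directionalSize N p q d θ ξ z) '' Set.univ))

theorem directionalSize_smul (N : Seminorm ℝ (ℝ × ℝ)) (hθ : θ ≠ p / q) (ξ : 𝓢(ℝ, Cd d))
    (z : ℝ × ℝ) {c : ℝ} (hc : c ≠ 0) :
    directionalSize N p q d θ ξ (c • z) = directionalSize N p q d θ ξ z := by
  rw [directionalSize, directionalSize, nabla_smul, moduleNormReal_smul hθ, map_smul_eq_mul,
    Complex.norm_real, mul_left_comm]
  exact mul_div_mul_left _ _ (norm_ne_zero_iff.2 hc)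

section

variable {N : Seminorm ℝ (ℝ × ℝ)} {ξ : 𝓢(ℝ, Cd d)}

theorem two_pi_mul_pos (hN : ∀ z, N z = 0 → z = 0) (hθ : θ ≠ p / q) {z : ℝ × ℝ} (hz : z ≠ 0) :
    0 < 2 * Real.pi * |θ - p / q| * N z :=
  mul_pos (mul_pos Real.two_pi_pos (abs_pos.2 (sub_ne_zero.2 hθ)))
    ((apply_nonneg N z).lt_of_ne fun h => hz (hN z h.symm))

theorem quotient_eq_ofReal (hN : ∀ z, N z = 0 → z = 0) (hθ : θ ≠ p / q) {z : ℝ × ℝ} (hz : z ≠ 0)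
    (η : 𝓢(ℝ, Cd d)) :
    moduleNorm p q d θ η / ENNReal.ofReal (2 * Real.pi * |θ - p / q| * N z) =
      ENNReal.ofReal (moduleNormReal p q d θ η / (2 * Real.pi * |θ - p / q| * N z)) := by
  rw [moduleNorm_eq hθ, ENNReal.ofReal_div_of_pos (two_pi_mul_pos hN hθ hz)]

theorem dNorm_le_ofReal (hq : 0 < q) (hqd : q ∣ d) (hN : ∀ z, N z = 0 → z = 0) (hθ : θ ≠ p / q)
    (hbdd : BddAbove ((fun z : Metric.sphere (0 : ℝ × ℝ) 1 =>
      directionalSize N p q d θ ξ z) '' Set.univ)) :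
    dNorm N p q d θ ξ ≤ ENNReal.ofReal (dNormReal N p q d θ ξ) := by
  refine sup_le ?_ (iSup₂_le fun z hz => ?_)
  · rw [moduleNorm_eq hθ]
    exact ENNReal.ofReal_le_ofReal (le_max_left _ _)
  · rw [quotient_eq_ofReal hN hθ hz]
    refine ENNReal.ofReal_le_ofReal (le_trans ?_ (le_max_right _ _))
    have hz' : ‖z‖⁻¹ ≠ 0 := inv_ne_zero (norm_ne_zero_iff.2 hz)
    have hmem : ‖z‖⁻¹ • z ∈ Metric.sphere (0 : ℝ × ℝ) 1 := by
      rw [mem_sphere_zero_iff_norm, norm_smul, norm_inv, norm_norm,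
        inv_mul_cancel₀ (norm_ne_zero_iff.2 hz)]
    calc moduleNormReal p q d θ (schrodinger (θ - p / q) z.1 z.2 ξ - ξ) /
          (2 * Real.pi * |θ - p / q| * N z) ≤ directionalSize N p q d θ ξ z :=
        div_le_div_of_nonneg_right (moduleNormReal_schrodinger_sub_le hq hqd hθ z ξ)
          (two_pi_mul_pos hN hθ hz).le
      _ = directionalSize N p q d θ ξ (‖z‖⁻¹ • z) := (directionalSize_smul N hθ ξ z hz').symm
      _ ≤ _ := le_csSup hbdd ⟨⟨_, hmem⟩, Set.mem_univ _, rfl⟩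

theorem directionalSize_le_toReal (hN : ∀ z, N z = 0 → z = 0) (hθ : θ ≠ p / q)
    (htop : dNorm N p q d θ ξ ≠ ⊤) {z : ℝ × ℝ} (hz : z ≠ 0) :
    directionalSize N p q d θ ξ z ≤ (dNorm N p q d θ ξ).toReal := by
  refine le_of_tendsto ((tendsto_moduleNormReal_diffQuot hθ z ξ).div_const _) ?_
  filter_upwards [self_mem_nhdsWithin] with t ht
  have ht : 0 < t := ht
  have htz : t • z ≠ 0 := smul_ne_zero ht.ne' hz
  have e : moduleNormReal p q d θ (diffQuot (θ - p / q) z t ξ) /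
      (2 * Real.pi * |θ - p / q| * N z) =
      moduleNormReal p q d θ (schrodinger (θ - p / q) (t • z).1 (t • z).2 ξ - ξ) /
        (2 * Real.pi * |θ - p / q| * N (t • z)) := by
    rw [moduleNormReal_diffQuot hθ z ξ ht, map_smul_eq_mul, Real.norm_of_nonneg ht.le,
      mul_left_comm _ t, inv_mul_eq_div, div_div]
    rfl
  rw [e, ← ENNReal.ofReal_le_iff_le_toReal htop, ← quotient_eq_ofReal hN hθ htz]
  exact le_sup_of_le_right (le_iSup₂_of_le (t • z) htz le_rfl)

/-- The difference quotients along a ray are bounded by, and converge to, the derivative, so that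
the D-norm only depends on the derivatives. -/
theorem dNorm_ne_top_and_toReal_eq (hq : 0 < q) (hqd : q ∣ d) (hN : ∀ z, N z = 0 → z = 0)
    (hθ : θ ≠ p / q)
    (hbdd : BddAbove ((fun z : Metric.sphere (0 : ℝ × ℝ) 1 =>
      directionalSize N p q d θ ξ z) '' Set.univ)) :
    dNorm N p q d θ ξ ≠ ⊤ ∧ (dNorm N p q d θ ξ).toReal = dNormReal N p q d θ ξ := by
  have hle := dNorm_le_ofReal hq hqd hN hθ hbdd
  have htop : dNorm N p q d θ ξ ≠ ⊤ := ne_top_of_le_ne_top ENNReal.ofReal_ne_top hle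
  have h0 : 0 ≤ dNormReal N p q d θ ξ := (moduleNormReal_nonneg ξ).trans (le_max_left _ _)
  refine ⟨htop, le_antisymm (ENNReal.toReal_le_of_le_ofReal h0 hle) (max_le ?_ ?_)⟩
  · rw [← ENNReal.ofReal_le_iff_le_toReal htop, ← moduleNorm_eq hθ]
    exact le_sup_left
  · refine Real.sSup_le ?_ ENNReal.toReal_nonneg
    rintro _ ⟨z, -, rfl⟩
    exact directionalSize_le_toReal hN hθ htop (ne_zero_of_mem_unit_sphere z)

end

/-! ### Rescaled functions -/

theorem derivS_rescale (r : {r : ℝ // r ≠ 0}) (ξ : 𝓢(ℝ, Cd d)) :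
    derivS (rescale r ξ) = ((r : ℝ) : ℂ) • rescale r (derivS ξ) := by
  ext1 s
  have h : HasDerivAt (fun s : ℝ => ξ (r.1 * s)) (r.1 • derivS ξ (r.1 * s)) s := by
    have h1 : HasDerivAt (fun s : ℝ => r.1 * s) r.1 s := by
      simpa using (hasDerivAt_id s).const_mul r.1
    exact (hasDerivAt_derivS ξ (r.1 * s)).scomp s h1
  have e : (fun s : ℝ => ξ (r.1 * s)) = (rescale r ξ : ℝ → Cd d) :=
    funext fun s => (rescale_apply r ξ s).symm
  rw [e] at h
  rw [(hasDerivAt_derivS (rescale r ξ) s).unique h, smul_apply, rescale_apply, Complex.coe_smul]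

/-- The growth of the decay constants under rescaling by `r`. -/
noncomputable def rescaleConst (r : ℝ) : ℝ := (1 + (r ^ 2)⁻¹) ^ 2 * (1 + r ^ 2)

theorem hasDecay_rescale {B : ℝ} {ξ : 𝓢(ℝ, Cd d)} (h : HasDecay B ξ) (r : {r : ℝ // r ≠ 0}) :
    HasDecay ((1 + (r.1 ^ 2)⁻¹) ^ 2 * B) (rescale r ξ) := fun s => by
  have hr : r.1 ^ 2 ≠ 0 := pow_ne_zero 2 r.2
  have h1 : 1 + s ^ 2 ≤ (1 + (r.1 ^ 2)⁻¹) * (1 + (r.1 * s) ^ 2) := by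
    have e : (r.1 ^ 2)⁻¹ * (r.1 * s) ^ 2 = s ^ 2 := by
      rw [mul_pow, inv_mul_cancel_left₀ hr]
    have p1 : 0 ≤ (r.1 ^ 2)⁻¹ := by positivity
    nlinarith [sq_nonneg (r.1 * s)]
  rw [rescale_apply]
  calc (1 + s ^ 2) ^ 2 * ‖ξ (r.1 * s)‖
      ≤ ((1 + (r.1 ^ 2)⁻¹) * (1 + (r.1 * s) ^ 2)) ^ 2 * ‖ξ (r.1 * s)‖ := by gcongr
    _ = (1 + (r.1 ^ 2)⁻¹) ^ 2 * ((1 + (r.1 * s) ^ 2) ^ 2 * ‖ξ (r.1 * s)‖) := by ring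
    _ ≤ _ := by gcongr; exact h _

theorem hasDecay₂_rescale {B : ℝ} {ξ : 𝓢(ℝ, Cd d)} (h : HasDecay₂ B ξ) (r : {r : ℝ // r ≠ 0}) :
    HasDecay₂ (rescaleConst r.1 * B) (rescale r ξ) := by
  have hB := h.1.nonneg
  have key : ∀ (c : ℝ), c ≤ 1 + r.1 ^ 2 →
      c * ((1 + (r.1 ^ 2)⁻¹) ^ 2 * B) ≤ rescaleConst r.1 * B := fun c hc => by
    rw [rescaleConst, mul_comm (_ ^ 2) (1 + r.1 ^ 2), mul_assoc]
    gcongr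
  have hr1 : ‖((r : ℝ) : ℂ)‖ ≤ 1 + r.1 ^ 2 := by
    rw [Complex.norm_real, Real.norm_eq_abs]
    nlinarith [sq_nonneg (|r.1| - 1), sq_abs r.1, abs_nonneg r.1]
  have hr2 : ‖((r : ℝ) : ℂ)‖ * ‖((r : ℝ) : ℂ)‖ ≤ 1 + r.1 ^ 2 := by
    rw [Complex.norm_real, Real.norm_eq_abs, abs_mul_abs_self]
    linarith [sq r.1]
  refine ⟨(hasDecay_rescale h.1 r).mono ?_, ?_, ?_⟩
  · simpa using key 1 (le_add_of_nonneg_right (sq_nonneg _))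
  · rw [derivS_rescale]
    exact ((hasDecay_rescale h.2.1 r).smul _).mono (key _ hr1)
  · rw [derivS_rescale, derivS, map_smul]
    change HasDecay _ (_ • derivS (rescale r (derivS ξ)))
    rw [derivS_rescale]
    refine (((hasDecay_rescale h.2.2 r).smul _).smul _).mono ?_
    rw [← mul_assoc]
    exact key _ hr2

theorem mulX_rescale (r : {r : ℝ // r ≠ 0}) (ξ : 𝓢(ℝ, Cd d)) :
    mulX (rescale r ξ) = ((r.1⁻¹ : ℝ) : ℂ) • rescale r (mulX ξ) := by
  ext1 s
  rw [mulX_apply, smul_apply, rescale_apply, rescale_apply, mulX_apply, smul_smul,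
    ← Complex.ofReal_mul, inv_mul_cancel_left₀ r.2]

theorem nabla_rescale (ð : ℝ) (z : ℝ × ℝ) (r : {r : ℝ // r ≠ 0}) (ξ : 𝓢(ℝ, Cd d)) :
    nabla ð z (rescale r ξ) =
      (2 * Real.pi * z.1 * Complex.I * ((r.1⁻¹ : ℝ) : ℂ)) • rescale r (mulX ξ) +
        (((ð * z.2 : ℝ) : ℂ) * ((r.1 : ℝ) : ℂ)) • rescale r (derivS ξ) := by
  rw [nabla, mulX_rescale, derivS_rescale, smul_smul, smul_smul]

theorem continuous_rescaleConst : Continuous fun r : {r : ℝ // r ≠ 0} => rescaleConst r.1 := by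
  unfold rescaleConst
  have h : Continuous fun r : {r : ℝ // r ≠ 0} => (r.1 ^ 2)⁻¹ :=
    (continuous_subtype_val.pow 2).inv₀ fun r => pow_ne_zero 2 r.2
  fun_prop

/-! ### Continuity of the D-norm -/

variable {ρ : {θ : ℝ // θ ≠ (p : ℝ) / q} → {r : ℝ // r ≠ 0}}

theorem continuous_moduleNormReal_rescale (hρ : Continuous ρ) (ξ : 𝓢(ℝ, Cd d)) :
    Continuous fun θ : {θ : ℝ // θ ≠ (p : ℝ) / q} =>
      moduleNormReal p q d θ (rescale (ρ θ) ξ) := by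
  obtain ⟨B, hB⟩ := exists_hasDecay₂ ξ
  refine continuous_moduleNormReal continuous_subtype_val (fun θ => θ.2)
    (K := fun θ => rescaleConst (ρ θ).1 * B)
    ((continuous_rescaleConst.comp hρ).mul continuous_const) (fun θ => hasDecay₂_rescale hB _) ?_
  simp only [rescale_apply]
  exact ξ.continuous.comp
    ((continuous_subtype_val.comp (hρ.comp continuous_fst)).mul continuous_snd)

theorem continuous_moduleNormReal_nabla_rescale (hρ : Continuous ρ) (ξ : 𝓢(ℝ, Cd d)) :
    Continuous fun x : {θ : ℝ // θ ≠ (p : ℝ) / q} × Metric.sphere (0 : ℝ × ℝ) 1 =>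
      moduleNormReal p q d x.1 (nabla (x.1 - p / q) x.2 (rescale (ρ x.1) ξ)) := by
  obtain ⟨A, hA⟩ := exists_hasDecay₂ (mulX ξ)
  obtain ⟨B, hB⟩ := exists_hasDecay₂ (derivS ξ)
  have hθ : Continuous fun x : {θ : ℝ // θ ≠ (p : ℝ) / q} × Metric.sphere (0 : ℝ × ℝ) 1 =>
      (x.1 : ℝ) := continuous_subtype_val.comp continuous_fst
  have hz : Continuous fun x : {θ : ℝ // θ ≠ (p : ℝ) / q} × Metric.sphere (0 : ℝ × ℝ) 1 =>
      (x.2 : ℝ × ℝ) := continuous_subtype_val.comp continuous_snd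
  have hr : Continuous fun x : {θ : ℝ // θ ≠ (p : ℝ) / q} × Metric.sphere (0 : ℝ × ℝ) 1 =>
      (ρ x.1 : ℝ) := continuous_subtype_val.comp (hρ.comp continuous_fst)
  have hri : Continuous fun x : {θ : ℝ // θ ≠ (p : ℝ) / q} × Metric.sphere (0 : ℝ × ℝ) 1 =>
      (ρ x.1 : ℝ)⁻¹ := hr.inv₀ fun x => (ρ x.1).2
  have hR := continuous_rescaleConst.comp (hρ.comp (continuous_fst (X := {θ : ℝ // θ ≠ (p : ℝ) / q})
    (Y := Metric.sphere (0 : ℝ × ℝ) 1)))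
  have hc1 : Continuous fun x : {θ : ℝ // θ ≠ (p : ℝ) / q} × Metric.sphere (0 : ℝ × ℝ) 1 =>
      (2 * Real.pi * (x.2 : ℝ × ℝ).1 * Complex.I * (((ρ x.1 : ℝ)⁻¹ : ℝ) : ℂ) : ℂ) :=
    ((continuous_const.mul (Complex.continuous_ofReal.comp (continuous_fst.comp hz))).mul
      continuous_const).mul (Complex.continuous_ofReal.comp hri)
  have hc2 : Continuous fun x : {θ : ℝ // θ ≠ (p : ℝ) / q} × Metric.sphere (0 : ℝ × ℝ) 1 =>
      ((((x.1 - p / q) * (x.2 : ℝ × ℝ).2 : ℝ) : ℂ) * ((ρ x.1 : ℝ) : ℂ) : ℂ) :=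
    (Complex.continuous_ofReal.comp ((hθ.sub continuous_const).mul (continuous_snd.comp hz))).mul
      (Complex.continuous_ofReal.comp hr)
  simp only [nabla_rescale]
  refine continuous_moduleNormReal hθ (fun x => x.1.2)
    (K := fun x =>
      ‖(2 * Real.pi * (x.2 : ℝ × ℝ).1 * Complex.I * (((ρ x.1 : ℝ)⁻¹ : ℝ) : ℂ) : ℂ)‖ *
        (rescaleConst (ρ x.1) * A) +
      ‖((((x.1 - p / q) * (x.2 : ℝ × ℝ).2 : ℝ) : ℂ) * ((ρ x.1 : ℝ) : ℂ) : ℂ)‖ *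
        (rescaleConst (ρ x.1) * B))
    ((hc1.norm.mul (hR.mul continuous_const)).add (hc2.norm.mul (hR.mul continuous_const)))
    (fun x => ((hasDecay₂_rescale hA _).smul _).add ((hasDecay₂_rescale hB _).smul _)) ?_
  simp only [add_apply, smul_apply, rescale_apply]
  have hrs := (hr.comp continuous_fst).mul (continuous_snd (X := {θ : ℝ // θ ≠ (p : ℝ) / q} ×
    Metric.sphere (0 : ℝ × ℝ) 1) (Y := ℝ))
  exact ((hc1.comp continuous_fst).smul ((mulX ξ).continuous.comp hrs)).add
    ((hc2.comp continuous_fst).smul ((derivS ξ).continuous.comp hrs))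

theorem continuous_directionalSize_rescale {N : Seminorm ℝ (ℝ × ℝ)} (hN : ∀ z, N z = 0 → z = 0)
    (hρ : Continuous ρ) (ξ : 𝓢(ℝ, Cd d)) :
    Continuous fun x : {θ : ℝ // θ ≠ (p : ℝ) / q} × Metric.sphere (0 : ℝ × ℝ) 1 =>
      directionalSize N p q d x.1 (rescale (ρ x.1) ξ) x.2 := by
  refine (continuous_moduleNormReal_nabla_rescale hρ ξ).div ?_ fun x =>
    (two_pi_mul_pos hN x.1.2 (ne_zero_of_mem_unit_sphere x.2)).ne'
  have hθ : Continuous fun x : {θ : ℝ // θ ≠ (p : ℝ) / q} × Metric.sphere (0 : ℝ × ℝ) 1 =>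
      (x.1 : ℝ) := continuous_subtype_val.comp continuous_fst
  exact (continuous_const.mul (hθ.sub continuous_const).abs).mul
    ((continuous_seminorm_prod N).comp (continuous_subtype_val.comp continuous_snd))

end

end Heisenberg

theorem mainTheorem2 (p : ℤ) (q d : ℕ) (hq : 0 < q) (hd : 0 < d) (hqd : q ∣ d)
    (N : Seminorm ℝ (ℝ × ℝ)) (hN : ∀ z, N z = 0 → z = 0)
    (ξ : SchwartzMap ℝ (EuclideanSpace ℂ (Fin d)))
    (ρ : {θ : ℝ // θ ≠ (p : ℝ) / q} → {r : ℝ // r ≠ 0}) (hρ : Continuous ρ) :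
    (∀ θ : {θ : ℝ // θ ≠ (p : ℝ) / q},
      (∀ η ω : SchwartzMap ℝ (EuclideanSpace ℂ (Fin d)),
        Summable fun a => ‖Heisenberg.moduleInner p q d θ η ω a‖) ∧
      Heisenberg.dNorm N p q d θ (Heisenberg.rescale (ρ θ) ξ) < ⊤) ∧
    Continuous fun θ : {θ : ℝ // θ ≠ (p : ℝ) / q} =>
      (Heisenberg.dNorm N p q d θ (Heisenberg.rescale (ρ θ) ξ)).toReal := by
  have hcont := Heisenberg.continuous_directionalSize_rescale hN hρ ξ
  have hdNorm := fun θ : {θ : ℝ // θ ≠ (p : ℝ) / q} =>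
    Heisenberg.dNorm_ne_top_and_toReal_eq (ξ := Heisenberg.rescale (ρ θ) ξ) hq hqd hN θ.2
      (isCompact_univ.image (hcont.comp (Continuous.prodMk_right θ))).bddAbove
  refine ⟨fun θ => ⟨Heisenberg.summable_moduleInner θ.2, (hdNorm θ).1.lt_top⟩, ?_⟩
  simp only [fun θ => (hdNorm θ).2]
  exact (Heisenberg.continuous_moduleNormReal_rescale hρ ξ).max
    (isCompact_univ.continuous_sSup hcont)
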